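/- **Thermal area law for fermion lattice systems.** Let $\Gamma$ be a lattice (a set of sites) and let $\mathcal A$ be the CAR algebra over $\Gamma$, i.e. the $C^*$-algebra generated by annihilation operators $c_i$ ($i\in\Gamma$) with $\{c_i^*,c_j\}=\delta_{ij}\mathbf 1$ and $\{c_i,c_j\}=0$. For $I\subset\Gamma$ let $\mathcal A(I)$ be the $C^*$-subalgebra generated by $\{c_i : i\in I\}$; for finite $I$ it is isomorphic to $M_{2^{|I|}}(\mathbb C)$. Let $\Theta$ be the automorphism with $\Theta(c_i)=-c_i$; an element $a$ is even if $\Theta(a)=a$, and a state $\psi$ is even if $\psi\circ\Theta=\psi$. Let $\psi_I$ denote the restriction of a state $\psi$ to $\mathcal A(I)$. *Entropies.* For a state $\psi$ and finite $I$ let $S_I(\psi)=-\mathrm{Tr}(D\log D)$, where $D$ is the density matrix of $\psi_I$ with respect to the matrix trace $\mathrm{Tr}$ on $\mathcal A(I)$. For finite $I$ and $J\subset I^c$, finite or infinite, put $$\widetilde S_{I|J}(\psi)=\inf_{\Lambda\subset J,\ \Lambda\text{ finite}}\bigl\{S_{I\cup\Lambda}(\psi)-S_\Lambda(\psi)\bigr\},\qquad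 I_\psi(I:J)=S_I(\psi)-\widetilde S_{I|J}(\psi),$$ and $\widetilde S_I(\psi)=\widetilde S_{I|I^c}(\psi)$. *Thermal equilibrium.* An even potential is a map $\Phi$ that assigns to each finite $K\subset\Gamma$ an even self-adjoint element $\Phi(K)\in\mathcal A(K)$. Assume that for every finite $I$ the surface energy $$H_{\partial I}=\sum_{K:\ K\cap I\ne\emptyset,\ K\cap I^c\ne\emptyset}\Phi(K)\in\mathcal A$$ exists, as the norm limit of the partial sums over $K\subset\Lambda$ along the finite regions $\Lambda\nearrow\Gamma$, and let $H_I=\sum_{K\subset I}\Phi(K)$. For $\beta>0$, a state $\varphi$ of $\mathcal A$ satisfies local thermodynamical stability (LTS) with respect to $\Phi$ at inverse temperature $\beta$ if for every finite $I$ $$\varphi(H_I+H_{\partial I})-\tfrac1\beta\widetilde S_I(\varphi)\ \le\ \psi(H_I+H_{\partial I})-\tfrac1\beta\widetilde S_I(\psi)$$ for all states $\psi$ of $\mathcal A$ with $\psi_{I^c}=\varphi_{I^c}$. **Theorem.** Let $\Phi$ be an even potential whose surface energies all exist, let $\beta>0$, and let $\varphi$ be an even state of $\mathcal A$ that satisfies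 LTS with respect to $\Phi$ at $\beta$. Let $A\subset\Gamma$ be finite. Then there is a unique state $\varphi_A\otimes_{\mathrm{car}}\varphi_{A^c}$ of $\mathcal A$ (the product-state extension) with $$(\varphi_A\otimes_{\mathrm{car}}\varphi_{A^c})(ab)=\varphi(a)\varphi(b)\qquad(a\in\mathcal A(A),\ b\in\mathcal A(A^c)),$$ and for every finite or infinite $B\subset A^c$ $$I_\varphi(A:B)\ \le\ I_\varphi(A:A^c)\ \le\ \beta\,(\varphi_A\otimes_{\mathrm{car}}\varphi_{A^c}-\varphi)(H_{\partial A})\ \le\ 2\beta\,\|H_{\partial A}\|.$$ -/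

import Mathlib

open Filter Topology
open scoped ComplexOrder ComplexConjugate

/-! ### The fermion Fock space and the CAR algebra over a set `Γ` of sites -/

/-- The fermion Fock space over the sites `Γ`: the Hilbert space with orthonormal basis `e_S`
indexed by the finite sets `S` of occupied sites. -/
abbrev FermionFock (Γ : Type*) : Type _ := lp (fun _ : Finset Γ => ℂ) 2

section WeightedComp

variable {ι : Type*}

/-- Square-summability of `S ↦ w S * f (g S)` together with the norm estimate. -/
theorem sum_weighted_comp_le (w : ι → ℂ) (g : ι → ι) (hw : ∀ S, ‖w S‖ ≤ 1)
    (hg : Set.InjOn g {S | w S ≠ 0}) (f : lp (fun _ : ι => ℂ) 2) (s : Finset ι) :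
    ∑ S ∈ s, ‖w S * f (g S)‖ ^ (2 : ENNReal).toReal ≤ ‖f‖ ^ (2 : ENNReal).toReal := by
  classical
  have h2 : (0 : ℝ) < (2 : ENNReal).toReal := by norm_num
  calc ∑ S ∈ s, ‖w S * f (g S)‖ ^ (2 : ENNReal).toReal
      = ∑ S ∈ s with w S ≠ 0, ‖w S * f (g S)‖ ^ (2 : ENNReal).toReal := by
        rw [Finset.sum_filter]
        refine Finset.sum_congr rfl fun S _ => ?_
        by_cases h : w S = 0
        · simp [h]
        · simp [h]
    _ ≤ ∑ S ∈ s with w S ≠ 0, ‖f (g S)‖ ^ (2 : ENNReal).toReal := by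
        refine Finset.sum_le_sum fun S _ => ?_
        refine Real.rpow_le_rpow (norm_nonneg _) ?_ h2.le
        rw [norm_mul]
        exact mul_le_of_le_one_left (norm_nonneg _) (hw S)
    _ = ∑ S ∈ (s.filter fun S => w S ≠ 0).image g, ‖f S‖ ^ (2 : ENNReal).toReal := by
        rw [Finset.sum_image]
        intro x hx y hy h
        exact hg (by simpa using (Finset.mem_filter.1 hx).2)
          (by simpa using (Finset.mem_filter.1 hy).2) h
    _ ≤ ‖f‖ ^ (2 : ENNReal).toReal := lp.sum_rpow_le_norm_rpow h2 f _

/-- The bounded operator `(T f) S = w S * f (g S)` on `ℓ²(ι)`, where `|w| ≤ 1` and `g` is injective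
on the support of `w`. -/
noncomputable def weightedComp (w : ι → ℂ) (g : ι → ι) (hw : ∀ S, ‖w S‖ ≤ 1)
    (hg : Set.InjOn g {S | w S ≠ 0}) :
    lp (fun _ : ι => ℂ) 2 →L[ℂ] lp (fun _ : ι => ℂ) 2 :=
  LinearMap.mkContinuous
    { toFun := fun f => ⟨fun S => w S * f (g S), memℓp_gen' (sum_weighted_comp_le w g hw hg f)⟩
      map_add' := fun f₁ f₂ => by ext S; exact mul_add _ _ _
      map_smul' := fun a f => by ext S; exact mul_left_comm _ _ _ }
    1
    (fun f => by
      rw [one_mul]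
      exact lp.norm_le_of_forall_sum_le (by norm_num) (norm_nonneg _)
        (sum_weighted_comp_le w g hw hg f))

@[simp] theorem weightedComp_apply (w : ι → ℂ) (g : ι → ι) (hw : ∀ S, ‖w S‖ ≤ 1)
    (hg : Set.InjOn g {S | w S ≠ 0}) (f : lp (fun _ : ι => ℂ) 2) (S : ι) :
    weightedComp w g hw hg f S = w S * f (g S) := rfl

end WeightedComp

section CAR

variable {Γ : Type*}

open scoped Classical in
/-- The fermionic sign `(-1) ^ #{j ∈ S : j < i}` for a fixed well-ordering `<` of the sites. -/
noncomputable def fermionSign (i : Γ) (S : Finset Γ) : ℂ :=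
  (-1) ^ (S.filter fun j => WellOrderingRel j i).card

theorem norm_fermionSign (i : Γ) (S : Finset Γ) : ‖fermionSign i S‖ = 1 := by
  simp [fermionSign]

open scoped Classical in
/-- The annihilation operator at `i`: `c_i e_S = ± e_{S \ {i}}` if `i ∈ S`, and `c_i e_S = 0`
otherwise. In coordinates, `(c_i f)(S) = ± f (S ∪ {i})` if `i ∉ S`, and `(c_i f)(S) = 0`
otherwise. -/
noncomputable def fockAnnihilate (i : Γ) : FermionFock Γ →L[ℂ] FermionFock Γ :=
  weightedComp (fun S => if i ∈ S then 0 else fermionSign i S) (fun S => insert i S)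
    (fun S => by
      split_ifs
      · simp
      · exact (norm_fermionSign i S).le)
    (by
      intro S hS T hT h
      have hS' : i ∉ S := fun hi => hS (if_pos hi)
      have hT' : i ∉ T := fun hi => hT (if_pos hi)
      dsimp only at h
      rw [← Finset.erase_insert hS', h, Finset.erase_insert hT'])

open scoped Classical in
theorem fermionSign_insert (i j : Γ) (S : Finset Γ) (hj : j ∉ S) :
    fermionSign i (insert j S) = (if WellOrderingRel j i then -1 else 1) * fermionSign i S := by
  unfold fermionSign
  rw [Finset.filter_insert]
  split_ifs with h
  · rw [Finset.card_insert_of_notMem (by simp [hj]), pow_succ]; ring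
  · simp

theorem fermionSign_mul_self (i : Γ) (S : Finset Γ) : fermionSign i S * fermionSign i S = 1 := by
  unfold fermionSign; rw [← mul_pow]; simp

open scoped Classical in
theorem fockAnnihilate_apply (i : Γ) (f : FermionFock Γ) (S : Finset Γ) :
    (fockAnnihilate i f) S = if i ∈ S then 0 else fermionSign i S * f (insert i S) := by
  change (if i ∈ S then 0 else fermionSign i S) * f (insert i S) = _
  split_ifs <;> simp

open scoped Classical in
/-- The coordinate form of the creation operator `c_i^*`. -/
theorem star_fockAnnihilate_apply (i : Γ) (f : FermionFock Γ) (S : Finset Γ) :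
    (star (fockAnnihilate i) f) S = if i ∈ S then fermionSign i S * f (S.erase i) else 0 := by
  have hcr : ∃ T : FermionFock Γ →L[ℂ] FermionFock Γ, ∀ f S,
      (T f) S = (if i ∈ S then fermionSign i S else 0) * f (S.erase i) := by
    refine ⟨weightedComp _ _ (fun S => ?_) ?_, fun f S => rfl⟩
    · split_ifs
      · exact (norm_fermionSign i S).le
      · simp
    · intro S hS T hT h
      have hS' : i ∈ S := by_contra fun hi => hS (if_neg hi)
      have hT' : i ∈ T := by_contra fun hi => hT (if_neg hi)
      replace h : S.erase i = T.erase i := h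
      rw [← Finset.insert_erase hS', h, Finset.insert_erase hT']
  obtain ⟨T, hT⟩ := hcr
  have hadj : T = star (fockAnnihilate i) := by
    rw [ContinuousLinearMap.star_eq_adjoint, ContinuousLinearMap.eq_adjoint_iff]
    intro f g
    rw [lp.inner_eq_tsum, lp.inner_eq_tsum]
    have hinv : Function.Involutive
        (fun S : Finset Γ => if i ∈ S then S.erase i else insert i S) := by
      intro S
      by_cases h : i ∈ S <;> simp [h]
    rw [← Equiv.tsum_eq hinv.toPerm]
    refine tsum_congr fun S => ?_
    change inner ℂ ((T f) (if i ∈ S then S.erase i else insert i S))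
      (g (if i ∈ S then S.erase i else insert i S)) = _
    rw [hT, fockAnnihilate_apply]
    by_cases h : i ∈ S
    · simp [h]
    · have hirr : ¬ WellOrderingRel i i := irrefl_of WellOrderingRel i
      have hs : fermionSign i (insert i S) = fermionSign i S := by
        rw [fermionSign_insert i i S h, if_neg hirr, one_mul]
      have hconj : conj (fermionSign i S) = fermionSign i S := by
        simp [fermionSign]
      simp [h, hs, hconj]
      ring
  rw [← hadj, hT]
  split_ifs <;> simp

/-- The canonical anticommutation relation `{c_i, c_j} = 0`. -/
theorem fockAnnihilate_anticomm (i j : Γ) :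
    fockAnnihilate i * fockAnnihilate j + fockAnnihilate j * fockAnnihilate i = 0 := by
  classical
  ext f S
  change (fockAnnihilate i (fockAnnihilate j f)) S + (fockAnnihilate j (fockAnnihilate i f)) S = 0
  simp only [fockAnnihilate_apply, Finset.mem_insert]
  by_cases hij : i = j
  · subst hij
    simp
  · have hji : ¬ j = i := fun h => hij h.symm
    by_cases hi : i ∈ S
    · simp [hi]
    by_cases hj : j ∈ S
    · simp [hj]
    simp only [hi, hj, hij, hji, or_self, if_false]
    rw [fermionSign_insert j i S hi, fermionSign_insert i j S hj, Finset.insert_comm j i S]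
    rcases trichotomous_of WellOrderingRel i j with h | h | h
    · rw [if_pos h, if_neg (asymm_of WellOrderingRel h)]; ring
    · exact absurd h hij
    · rw [if_pos h, if_neg (asymm_of WellOrderingRel h)]; ring

open scoped Classical in
/-- The canonical anticommutation relation `{c_i^*, c_j} = δ_{ij}`. -/
theorem fockAnnihilate_star_anticomm (i j : Γ) :
    star (fockAnnihilate i) * fockAnnihilate j + fockAnnihilate j * star (fockAnnihilate i) =
      if i = j then 1 else 0 := by
  ext f S
  change (star (fockAnnihilate i) (fockAnnihilate j f)) S +
    (fockAnnihilate j (star (fockAnnihilate i) f)) S = _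
  simp only [fockAnnihilate_apply, star_fockAnnihilate_apply, Finset.mem_insert,
    Finset.mem_erase]
  by_cases hij : i = j
  · subst hij
    have hirr : ¬ WellOrderingRel i i := irrefl_of WellOrderingRel i
    by_cases hi : i ∈ S
    · obtain ⟨T, hT, rfl⟩ : ∃ T, i ∉ T ∧ S = insert i T :=
        ⟨S.erase i, by simp, (Finset.insert_erase hi).symm⟩
      simp only [fermionSign_insert i i T hT, hirr, if_false, one_mul, Finset.mem_insert, true_or,
        if_true, ne_eq, not_true_eq_false, false_and, Finset.erase_insert hT, add_zero,
        ← mul_assoc, fermionSign_mul_self]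
      rfl
    · simp only [hi, if_false, true_or, if_true, fermionSign_insert i i S hi, hirr, one_mul,
        Finset.erase_insert hi, zero_add, ← mul_assoc, fermionSign_mul_self]
      rfl
  · have hji : ¬ j = i := fun h => hij h.symm
    simp only [hij, hji, if_false, false_or, ne_eq, not_false_eq_true, true_and]
    by_cases hi : i ∈ S
    · by_cases hj : j ∈ S
      · simp [hj]
      · obtain ⟨T, hT, rfl⟩ : ∃ T, i ∉ T ∧ S = insert i T :=
          ⟨S.erase i, by simp, (Finset.insert_erase hi).symm⟩
        have hjT : j ∉ T := fun h => hj (Finset.mem_insert_of_mem h)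
        simp only [hi, hj, if_true, if_false]
        have hirr : ¬ WellOrderingRel i i := irrefl_of WellOrderingRel i
        rw [fermionSign_insert i j _ hj, fermionSign_insert i i T hT,
          fermionSign_insert j i T hT, Finset.insert_comm j i T, Finset.erase_insert hT,
          Finset.erase_insert (by simp [hij, hT])]
        change _ = (0 : ℂ)
        rcases trichotomous_of WellOrderingRel i j with h | h | h
        · rw [if_pos h, if_neg (asymm_of WellOrderingRel h), if_neg hirr]; ring
        · exact absurd h hij
        · rw [if_pos h, if_neg (asymm_of WellOrderingRel h), if_neg hirr]; ring
    · simp [hi]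

/-- The parity operator `(-1)^N`: `e_S ↦ (-1)^{|S|} e_S`. -/
noncomputable def fockParity (Γ : Type*) : FermionFock Γ →L[ℂ] FermionFock Γ :=
  weightedComp (fun S => (-1) ^ S.card) id (fun S => by simp) (Function.injective_id.injOn)

theorem fockParity_mul_self : fockParity Γ * fockParity Γ = 1 := by
  ext f S
  change (-1 : ℂ) ^ S.card * ((-1) ^ S.card * f S) = f S
  rw [← mul_assoc, ← mul_pow]
  simp

theorem star_fockParity : star (fockParity Γ) = fockParity Γ := by
  rw [ContinuousLinearMap.star_eq_adjoint]
  symm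
  rw [ContinuousLinearMap.eq_adjoint_iff]
  intro f g
  rw [lp.inner_eq_tsum, lp.inner_eq_tsum]
  refine tsum_congr fun S => ?_
  simp [fockParity, mul_left_comm, mul_assoc]

theorem fockParity_conj_annihilate (i : Γ) :
    fockParity Γ * fockAnnihilate i * fockParity Γ = -fockAnnihilate i := by
  classical
  ext f S
  change (-1 : ℂ) ^ S.card * ((if i ∈ S then 0 else fermionSign i S) *
    ((-1 : ℂ) ^ (insert i S).card * f (insert i S))) =
      -((if i ∈ S then 0 else fermionSign i S) * f (insert i S))
  by_cases h : i ∈ S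
  · simp [h]
  · rw [Finset.card_insert_of_notMem h, if_neg h, pow_succ]
    have : (-1 : ℂ) ^ S.card * (-1) ^ S.card = 1 := by rw [← mul_pow]; simp
    linear_combination (-(fermionSign i S * f (insert i S))) * this

/-- Conjugation by the parity operator, as a `*`-automorphism of all bounded operators. -/
noncomputable def fockGrading (Γ : Type*) :
    (FermionFock Γ →L[ℂ] FermionFock Γ) →⋆ₐ[ℂ] (FermionFock Γ →L[ℂ] FermionFock Γ) where
  toFun a := fockParity Γ * a * fockParity Γ
  map_one' := by simp [fockParity_mul_self]
  map_mul' a b := by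
    simp only [mul_assoc]
    rw [← mul_assoc (fockParity Γ) (fockParity Γ), fockParity_mul_self, one_mul]
  map_zero' := by simp
  map_add' a b := by simp [mul_add, add_mul]
  commutes' r := by
    rw [Algebra.algebraMap_eq_smul_one]
    simp [fockParity_mul_self]
  map_star' a := by
    simp [star_mul, star_fockParity, mul_assoc]

variable (Γ) in
/-- The CAR algebra over `Γ`, as the norm-closed `*`-algebra of operators on Fock space that is
generated by all annihilation operators. -/
noncomputable def carSubalgebra : StarSubalgebra ℂ (FermionFock Γ →L[ℂ] FermionFock Γ) :=
  (StarAlgebra.adjoin ℂ (Set.range (fockAnnihilate (Γ := Γ)))).topologicalClosure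

variable (Γ) in
/-- The `C*`-algebra of the fermion lattice system over `Γ`. -/
abbrev CARAlgebra : Type _ := ↥(carSubalgebra Γ)

/-- The annihilation operator `c_i` as an element of the CAR algebra; the creation operator is
`star (carC i)`. -/
noncomputable def carC (i : Γ) : CARAlgebra Γ :=
  ⟨fockAnnihilate i,
    StarSubalgebra.le_topologicalClosure _ (StarAlgebra.subset_adjoin ℂ _ ⟨i, rfl⟩)⟩

theorem fockGrading_mem (a : FermionFock Γ →L[ℂ] FermionFock Γ) (ha : a ∈ carSubalgebra Γ) :
    fockGrading Γ a ∈ carSubalgebra Γ := by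
  have hcont : Continuous (fockGrading Γ) := by
    change Continuous fun a => fockParity Γ * a * fockParity Γ
    fun_prop
  have hle : carSubalgebra Γ ≤ (carSubalgebra Γ).comap (fockGrading Γ) := by
    refine StarSubalgebra.topologicalClosure_minimal ?_ ?_
    · refine StarAlgebra.adjoin_le ?_
      rintro _ ⟨i, rfl⟩
      change fockParity Γ * fockAnnihilate i * fockParity Γ ∈ carSubalgebra Γ
      rw [fockParity_conj_annihilate]
      exact neg_mem (carC i).2
    · exact (StarSubalgebra.isClosed_topologicalClosure _).preimage hcont
  exact hle ha

variable (Γ) in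
/-- The fermion grading `Θ`, with `Θ (c_i) = - c_i`. -/
noncomputable def carGrading : CARAlgebra Γ →⋆ₐ[ℂ] CARAlgebra Γ :=
  ((fockGrading Γ).comp (carSubalgebra Γ).subtype).codRestrict (carSubalgebra Γ)
    (fun a => fockGrading_mem a.1 a.2)

theorem carGrading_carC (i : Γ) : carGrading Γ (carC i) = -carC i :=
  Subtype.ext (fockParity_conj_annihilate i)

/-- The algebra `𝓐(I)` of a finite or infinite region `I`: the `C*`-subalgebra generated by the
`c_i`, `i ∈ I`. -/
noncomputable def regionAlgebra (I : Set Γ) : StarSubalgebra ℂ (CARAlgebra Γ) :=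
  (StarAlgebra.adjoin ℂ (carC '' I)).topologicalClosure

/-! ### States -/

/-- A state of the CAR algebra: a positive normalized linear functional. -/
structure IsState (φ : CARAlgebra Γ →L[ℂ] ℂ) : Prop where
  nonneg : ∀ a, 0 ≤ φ (star a * a)
  map_one : φ 1 = 1

/-- Invariance under the fermion grading. -/
def IsEvenState (φ : CARAlgebra Γ →L[ℂ] ℂ) : Prop :=
  ∀ a, φ (carGrading Γ a) = φ a

/-- `ω` is a product-state extension `φ_I ⊗_car ψ_{Iᶜ}`: a state of the whole algebra with
`ω (a b) = φ a * ψ b` for all `a ∈ 𝓐(I)` and `b ∈ 𝓐(Iᶜ)`. -/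
structure IsCARProduct (I : Set Γ) (φ ψ ω : CARAlgebra Γ →L[ℂ] ℂ) : Prop where
  isState : IsState ω
  map_mul : ∀ a ∈ regionAlgebra I, ∀ b ∈ regionAlgebra Iᶜ, ω (a * b) = φ a * ψ b

/-! ### Entropies -/

/-- The product of the annihilation operators over the sites of `S`, in a fixed order. -/
noncomputable def carMonomial (S : Finset Γ) : CARAlgebra Γ :=
  (S.toList.map carC).prod

/-- The projection `∏_{i ∈ I} c_i c_i^*` onto the configurations without a particle in `I`
(the factors commute). -/
noncomputable def carVacuum (I : Finset Γ) : CARAlgebra Γ :=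
  (I.toList.map fun i => carC i * star (carC i)).prod

/-- The density matrix of the restriction of `ψ` to `𝓐(I)`, `I` finite. The elements
`E S T = star (carMonomial S) * carVacuum I * carMonomial T` with `S, T ⊆ I` are matrix units of
`𝓐(I) ≅ M_{2^|I|}(ℂ)`, and the density matrix `D` with `ψ a = Tr (D a)` on `𝓐(I)` has the entries
`D S T = ψ (E T S)`. The ordering of the factors in the monomials only changes `D` by conjugation
with a diagonal matrix of signs. -/
noncomputable def densityMatrix (I : Finset Γ) (ψ : CARAlgebra Γ →L[ℂ] ℂ) :
    Matrix I.powerset I.powerset ℂ :=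
  Matrix.of fun S T => ψ (star (carMonomial T.1) * carVacuum I * carMonomial S.1)

open scoped Classical in
/-- The von Neumann entropy `S_I(ψ) = - Tr (D log D)`, with `0 log 0 = 0`. -/
noncomputable def vonNeumannEntropy (I : Finset Γ) (ψ : CARAlgebra Γ →L[ℂ] ℂ) : ℝ :=
  -(Matrix.trace (densityMatrix I ψ * cfc Real.log (densityMatrix I ψ))).re

open scoped Classical in
/-- The conditional entropy of `ψ` on `I` given `J`: the infimum of `S_{I ∪ Λ}(ψ) - S_Λ(ψ)` over
all finite `Λ ⊆ J`, taken in the extended reals. -/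
noncomputable def condEntropy (I : Finset Γ) (J : Set Γ) (ψ : CARAlgebra Γ →L[ℂ] ℂ) : EReal :=
  ⨅ Λ : {Λ : Finset Γ // (Λ : Set Γ) ⊆ J},
    ((vonNeumannEntropy (I ∪ Λ.1) ψ - vonNeumannEntropy Λ.1 ψ : ℝ) : EReal)

/-- The mutual entropy of `ψ` between the finite region `I` and the region `J`. -/
noncomputable def mutualEntropy (ψ : CARAlgebra Γ →L[ℂ] ℂ) (I : Finset Γ) (J : Set Γ) : EReal :=
  (vonNeumannEntropy I ψ : EReal) - condEntropy I J ψ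

/-! ### Potentials and local thermodynamical stability -/

variable (Γ) in
/-- An even potential: a map `K ↦ Φ K` on finite regions with `Φ K = (Φ K)^*` in the even part of
`𝓐(K)`. -/
structure EvenPotential where
  toFun : Finset Γ → CARAlgebra Γ
  isSelfAdjoint : ∀ K, star (toFun K) = toFun K
  mem_region : ∀ K : Finset Γ, toFun K ∈ regionAlgebra (K : Set Γ)
  even : ∀ K, carGrading Γ (toFun K) = toFun K

/-- The inner local Hamiltonian `H_I`, the sum of `Φ K` over `K ⊆ I`. -/
noncomputable def EvenPotential.innerHamiltonian (Φ : EvenPotential Γ) (I : Finset Γ) :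
    CARAlgebra Γ :=
  ∑ K ∈ I.powerset, Φ.toFun K

open scoped Classical in
/-- The part of the surface energy of `I` inside the finite region `Λ`: the sum of `Φ K` over all
`K ⊆ Λ` that meet both `I` and its complement. -/
noncomputable def EvenPotential.surfacePart (Φ : EvenPotential Γ) (I Λ : Finset Γ) :
    CARAlgebra Γ :=
  ∑ K ∈ Λ.powerset with
    ((K ∩ I).Nonempty ∧ (K \ I).Nonempty), Φ.toFun K

/-- All surface energies exist: for each finite `I` the sum of `Φ K` over all `K` that meet both
`I` and its complement converges in norm along the finite regions `Λ ↗ Γ`. -/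
def EvenPotential.HasSurfaceEnergies (Φ : EvenPotential Γ) : Prop :=
  ∀ I : Finset Γ, ∃ H : CARAlgebra Γ, Tendsto (Φ.surfacePart I) atTop (𝓝 H)

/-- The surface energy `H_{∂I}`, meaningful under `HasSurfaceEnergies`. -/
noncomputable def EvenPotential.surfaceEnergy (Φ : EvenPotential Γ) (I : Finset Γ) :
    CARAlgebra Γ :=
  limUnder atTop (Φ.surfacePart I)

/-- The conditional free energy `ψ (H_I + H_{∂I}) - β⁻¹ S(ψ)` of a state `ψ` on `I`, where `S(ψ)`
is the conditional entropy on `I` given the complement of `I`. -/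
noncomputable def conditionalFreeEnergy (Φ : EvenPotential Γ) (β : ℝ) (I : Finset Γ)
    (ψ : CARAlgebra Γ →L[ℂ] ℂ) : EReal :=
  (((ψ (Φ.innerHamiltonian I + Φ.surfaceEnergy I)).re : ℝ) : EReal) -
    ((β⁻¹ : ℝ) : EReal) * condEntropy I (I : Set Γ)ᶜ ψ

/-- Local thermodynamical stability of `φ` with respect to `Φ` at inverse temperature `β`. -/
def IsLTS (Φ : EvenPotential Γ) (β : ℝ) (φ : CARAlgebra Γ →L[ℂ] ℂ) : Prop :=
  ∀ I : Finset Γ, ∀ ψ : CARAlgebra Γ →L[ℂ] ℂ, IsState ψ →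
    (∀ a ∈ regionAlgebra (I : Set Γ)ᶜ, ψ a = φ a) →
    conditionalFreeEnergy Φ β I φ ≤ conditionalFreeEnergy Φ β I ψ

end CAR

/-!
Local thermodynamical stability is tested on the product extension `ω = φ_A ⊗_car φ_{Aᶜ}`, which
agrees with `φ` outside `A` and is therefore a competitor. It also agrees with `φ` on `𝓐(A)`, so
`H_A` cancels and the energies differ by `(ω - φ) (H_{∂A})`. Since `φ` is even, the density matrix
of `ω` on `A ∪ Λ` is, up to conjugation by a diagonal matrix of signs, the Kronecker product of
those on `A` and `Λ`. Hence the entropy is additive and the conditional entropy of `ω` on `A` is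
`S_A(φ)`, so the stability inequality becomes the bound on the mutual entropy.

The state `ω` is built from the matrix units `E S T` of `𝓐(A)` by pairing `φ (E S T)` with the
values of `φ` on the matrix coefficients of an element; its positivity is the Schur product theorem
for two Gram matrices.
-/

section MatrixEntropy

open Matrix Polynomial
open scoped Kronecker

variable {𝕜 m n : Type*} [RCLike 𝕜] [Fintype m] [Fintype n]

theorem sum_entries_nonneg {M : Matrix m m 𝕜} (hM : M.PosSemidef) : 0 ≤ ∑ i, ∑ j, M i j := by
  simpa only [dotProduct, mulVec, Pi.star_apply, star_one, one_mul, mul_one] using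
    hM.dotProduct_mulVec_nonneg fun _ => 1

variable [DecidableEq n]

theorem trace_mul_cfc_eq_sum_eigenvalues {M : Matrix n n 𝕜} (hM : M.IsHermitian) (f : ℝ → ℝ) :
    (M * cfc f M).trace = ∑ i, (hM.eigenvalues i : 𝕜) * (f (hM.eigenvalues i) : 𝕜) := by
  rw [hM.cfc_eq, IsHermitian.cfc]
  nth_rewrite 1 [hM.spectral_theorem]
  rw [← map_mul, diagonal_mul_diagonal, Unitary.conjStarAlgAut_apply, trace_mul_comm, ← mul_assoc,
    Unitary.coe_star_mul_self, one_mul, trace_diagonal]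
  simp only [Function.comp_apply]

theorem trace_mul_cfc_eq_sum_of_charpoly_eq {M : Matrix n n 𝕜} (hM : M.IsHermitian) (f : ℝ → ℝ)
    {d : m → ℝ} (hd : M.charpoly = ∏ i, (X - C (d i : 𝕜))) :
    (M * cfc f M).trace = ∑ i, (d i : 𝕜) * (f (d i) : 𝕜) := by
  have hroots : M.charpoly.roots = Finset.univ.val.map fun i => (d i : 𝕜) := by
    rw [hd]
    simpa only [Finset.prod_eq_multiset_prod, Multiset.map_map, Function.comp_def] using
      roots_multiset_prod_X_sub_C (Finset.univ.val.map fun i => (d i : 𝕜))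
  rw [hM.roots_charpoly_eq_eigenvalues] at hroots
  have hsum := congrArg
    (fun s : Multiset 𝕜 => (s.map fun z => z * (f (RCLike.re z) : 𝕜)).sum) hroots
  simp only [Multiset.map_map, Function.comp_def, RCLike.ofReal_re] at hsum
  rw [trace_mul_cfc_eq_sum_eigenvalues hM]
  exact hsum

theorem trace_mul_cfc_congr_charpoly [DecidableEq m] {M : Matrix m m 𝕜} {N : Matrix n n 𝕜}
    (hM : M.IsHermitian) (hN : N.IsHermitian) (f : ℝ → ℝ) (h : M.charpoly = N.charpoly) :
    (M * cfc f M).trace = (N * cfc f N).trace := by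
  rw [trace_mul_cfc_eq_sum_of_charpoly_eq hM f (h.trans hN.charpoly_eq),
    trace_mul_cfc_eq_sum_eigenvalues hN]

variable [DecidableEq m] {A : Matrix m m 𝕜} {B : Matrix n n 𝕜}

theorem charpoly_kronecker_eq_prod (hA : A.IsHermitian) (hB : B.IsHermitian) :
    (A ⊗ₖ B).charpoly =
      ∏ p : m × n, (X - C ((hA.eigenvalues p.1 * hB.eigenvalues p.2 : ℝ) : 𝕜)) := by
  have h : A ⊗ₖ B =
      ((hA.eigenvectorUnitary : Matrix m m 𝕜) ⊗ₖ (hB.eigenvectorUnitary : Matrix n n 𝕜)) *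
      (diagonal (RCLike.ofReal ∘ hA.eigenvalues) ⊗ₖ diagonal (RCLike.ofReal ∘ hB.eigenvalues)) *
      (star (hA.eigenvectorUnitary : Matrix m m 𝕜) ⊗ₖ
        star (hB.eigenvectorUnitary : Matrix n n 𝕜)) := by
    rw [← mul_kronecker_mul, ← mul_kronecker_mul]
    nth_rewrite 1 [hA.spectral_theorem]
    nth_rewrite 1 [hB.spectral_theorem]
    simp only [Unitary.conjStarAlgAut_apply]
  rw [h, charpoly_mul_comm, ← mul_assoc, ← mul_kronecker_mul, Unitary.coe_star_mul_self,
    Unitary.coe_star_mul_self, one_kronecker_one, one_mul, diagonal_kronecker_diagonal,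
    charpoly_diagonal]
  simp only [Function.comp_apply, RCLike.ofReal_mul]

theorem trace_kronecker_mul_cfc_log (hA : A.IsHermitian) (hB : B.IsHermitian) :
    ((A ⊗ₖ B) * cfc Real.log (A ⊗ₖ B)).trace =
      (A * cfc Real.log A).trace * B.trace + A.trace * (B * cfc Real.log B).trace := by
  have hAB : (A ⊗ₖ B).IsHermitian := by
    rw [IsHermitian, conjTranspose_kronecker, hA.eq, hB.eq]
  have hlog : ∀ x y : ℝ, x * y * Real.log (x * y) =
      x * Real.log x * y + x * (y * Real.log y) := by
    intro x y
    rcases eq_or_ne x 0 with rfl | hx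
    · simp
    rcases eq_or_ne y 0 with rfl | hy
    · simp
    rw [Real.log_mul hx hy]
    ring
  rw [trace_mul_cfc_eq_sum_of_charpoly_eq hAB _ (charpoly_kronecker_eq_prod hA hB),
    trace_mul_cfc_eq_sum_eigenvalues hA, trace_mul_cfc_eq_sum_eigenvalues hB,
    hA.trace_eq_sum_eigenvalues, hB.trace_eq_sum_eigenvalues, Finset.sum_mul_sum,
    Finset.sum_mul_sum, Fintype.sum_prod_type, ← Finset.sum_add_distrib]
  simp only [← Finset.sum_add_distrib]
  exact_mod_cast Finset.sum_congr rfl fun i _ => Finset.sum_congr rfl fun j _ => hlog _ _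

end MatrixEntropy

section PositiveFunctionals

variable {B : Type*} [CStarAlgebra B]

theorem norm_positiveFunctional_apply_le [PartialOrder B] [StarOrderedRing B] (f : B →ₚ[ℂ] ℂ)
    (a : B) : ‖f a‖ ≤ ‖f 1‖ * ‖a‖ := by
  have hsq : ∀ b : B, ‖f.toPreGNS b‖ ^ 2 = ‖f (star b * b)‖ := fun b => by
    simpa only [norm_pow, Complex.norm_real, norm_norm, f.ofPreGNS_toPreGNS] using
      congrArg norm (f.preGNS_norm_sq (f.toPreGNS b))
  have hinner : inner ℂ (f.toPreGNS 1) (f.toPreGNS a) = f a := by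
    rw [f.preGNS_inner_def, f.ofPreGNS_toPreGNS, f.ofPreGNS_toPreGNS, star_one, one_mul]
  refine le_of_sq_le_sq ?_ (by positivity)
  calc ‖f a‖ ^ 2 ≤ (‖f.toPreGNS 1‖ * ‖f.toPreGNS a‖) ^ 2 := by
        rw [← hinner]
        gcongr
        exact norm_inner_le_norm _ _
    _ = ‖f 1‖ * ‖f (star a * a)‖ := by rw [mul_pow, hsq, hsq, star_one, one_mul]
    _ ≤ ‖f 1‖ * (‖f 1‖ * ‖star a * a‖) := by
        gcongr
        exact f.norm_apply_le_of_nonneg _ (star_mul_self_nonneg a)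
    _ = (‖f 1‖ * ‖a‖) ^ 2 := by rw [CStarRing.norm_star_mul_self]; ring

theorem exists_positiveFunctional_eq {f : B →ₗ[ℂ] ℂ} (hf : ∀ a, 0 ≤ f (star a * a)) :
    ∃ (_ : PartialOrder B) (_ : StarOrderedRing B) (g : B →ₚ[ℂ] ℂ), ∀ a, g a = f a := by
  let _ : PartialOrder B := CStarAlgebra.spectralOrder B
  have _ : StarOrderedRing B := CStarAlgebra.spectralOrderedRing B
  refine ⟨_, ‹_›, PositiveLinearMap.mk₀ f fun b hb => ?_, fun _ => rfl⟩
  obtain ⟨c, rfl⟩ := CStarAlgebra.nonneg_iff_eq_star_mul_self.1 hb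
  exact hf c

theorem norm_apply_le_of_star_mul_self_nonneg {f : B →ₗ[ℂ] ℂ} (hf : ∀ a, 0 ≤ f (star a * a))
    (a : B) : ‖f a‖ ≤ ‖f 1‖ * ‖a‖ := by
  obtain ⟨_, _, g, hg⟩ := exists_positiveFunctional_eq hf
  simpa only [hg] using norm_positiveFunctional_apply_le g a

theorem map_star_of_star_mul_self_nonneg {f : B →ₗ[ℂ] ℂ} (hf : ∀ a, 0 ≤ f (star a * a))
    (a : B) : f (star a) = conj (f a) := by
  obtain ⟨_, _, g, hg⟩ := exists_positiveFunctional_eq hf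
  simpa only [hg, starRingEnd_apply] using map_star g a

end PositiveFunctionals

section States

variable {Γ : Type*} {φ ψ : CARAlgebra Γ →L[ℂ] ℂ}

theorem isClosed_carSubalgebra :
    IsClosed (carSubalgebra Γ : Set (FermionFock Γ →L[ℂ] FermionFock Γ)) :=
  StarSubalgebra.isClosed_topologicalClosure _

theorem IsState.norm_apply_le (hφ : IsState φ) (a : CARAlgebra Γ) : ‖φ a‖ ≤ ‖a‖ := by
  let _ := StarSubalgebra.cstarAlgebra (carSubalgebra Γ) (h_closed := isClosed_carSubalgebra)
  simpa [hφ.map_one] using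
    norm_apply_le_of_star_mul_self_nonneg (f := φ.toLinearMap) hφ.nonneg a

theorem IsState.map_star (hφ : IsState φ) (a : CARAlgebra Γ) : φ (star a) = conj (φ a) := by
  let _ := StarSubalgebra.cstarAlgebra (carSubalgebra Γ) (h_closed := isClosed_carSubalgebra)
  exact map_star_of_star_mul_self_nonneg (f := φ.toLinearMap) hφ.nonneg a

theorem IsState.re_sub_apply_le (hφ : IsState φ) (hψ : IsState ψ) (a : CARAlgebra Γ) :
    ((φ - ψ) a).re ≤ 2 * ‖a‖ :=
  calc ((φ - ψ) a).re ≤ ‖φ a - ψ a‖ := Complex.re_le_norm _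
    _ ≤ ‖φ a‖ + ‖ψ a‖ := norm_sub_le _ _
    _ ≤ 2 * ‖a‖ := by linarith [hφ.norm_apply_le a, hψ.norm_apply_le a]

theorem IsState.posSemidef_gram (hφ : IsState φ) {ι : Type*} (a : ι → CARAlgebra Γ) :
    (Matrix.of fun i j => φ (star (a i) * a j)).PosSemidef := by
  refine ⟨?_, fun x => ?_⟩
  · ext i j
    simp [← hφ.map_star]
  · have h := hφ.nonneg (x.sum fun i c => c • a i)
    rw [Finsupp.sum, star_sum, Finset.sum_mul_sum] at h
    simpa [Finsupp.sum, smul_mul_smul_comm, mul_comm, mul_left_comm] using h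

end States

section RegionAlgebras

variable {Γ : Type*} {I J : Set Γ}

theorem carC_mul_carC (i j : Γ) : carC i * carC j = -(carC j * carC i) :=
  eq_neg_of_add_eq_zero_left (Subtype.ext (fockAnnihilate_anticomm i j))

theorem star_carC_mul_self_add (i : Γ) :
    star (carC i) * carC i + carC i * star (carC i) = 1 :=
  Subtype.ext ((fockAnnihilate_star_anticomm i i).trans (if_pos rfl))

theorem star_carC_mul_carC {i j : Γ} (h : i ≠ j) :
    star (carC i) * carC j = -(carC j * star (carC i)) :=
  eq_neg_of_add_eq_zero_left (Subtype.ext ((fockAnnihilate_star_anticomm i j).trans (if_neg h)))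

theorem continuous_carGrading : Continuous (carGrading Γ) :=
  Continuous.subtype_mk (f := fun a : CARAlgebra Γ => fockParity Γ * a.1 * fockParity Γ)
    (by fun_prop) _

theorem carGrading_sq : carGrading Γ ^ 2 = 1 := by
  refine StarAlgHom.ext fun a => Subtype.ext ?_
  change fockParity Γ * (fockParity Γ * a.1 * fockParity Γ) * fockParity Γ = a.1
  rw [← mul_assoc, ← mul_assoc, fockParity_mul_self, one_mul, mul_assoc, fockParity_mul_self,
    mul_one]

theorem carGrading_pow_apply_pow_apply (n : ℕ) (a : CARAlgebra Γ) :
    (carGrading Γ ^ n) ((carGrading Γ ^ n) a) = a := by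
  have h : carGrading Γ ^ n * carGrading Γ ^ n = 1 := by
    rw [← pow_add, ← two_mul, pow_mul, carGrading_sq, one_pow]
  exact DFunLike.congr_fun h a

theorem carC_mem_regionAlgebra {i : Γ} (hi : i ∈ I) : carC i ∈ regionAlgebra I :=
  StarSubalgebra.le_topologicalClosure _ (StarAlgebra.subset_adjoin ℂ _ ⟨i, hi, rfl⟩)

theorem isClosed_regionAlgebra : IsClosed (regionAlgebra I : Set (CARAlgebra Γ)) :=
  StarSubalgebra.isClosed_topologicalClosure _

theorem regionAlgebra_le {N : StarSubalgebra ℂ (CARAlgebra Γ)}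
    (hN : IsClosed (N : Set (CARAlgebra Γ))) (h : ∀ i ∈ I, carC i ∈ N) : regionAlgebra I ≤ N :=
  StarSubalgebra.topologicalClosure_minimal
    (StarAlgebra.adjoin_le (by rintro _ ⟨i, hi, rfl⟩; exact h i hi)) hN

theorem regionAlgebra_mono : Monotone (regionAlgebra (Γ := Γ)) := fun _ _ h =>
  regionAlgebra_le isClosed_regionAlgebra fun _ hi => carC_mem_regionAlgebra (h hi)

theorem regionAlgebra_induction {p : CARAlgebra Γ → Prop} (hclosed : IsClosed {a | p a})
    (hcarC : ∀ i ∈ I, p (carC i)) (hstar : ∀ i ∈ I, p (star (carC i)))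
    (halg : ∀ r : ℂ, p (algebraMap ℂ _ r)) (hadd : ∀ a b, p a → p b → p (a + b))
    (hmul : ∀ a b, p a → p b → p (a * b)) {a : CARAlgebra Γ} (ha : a ∈ regionAlgebra I) : p a := by
  refine closure_minimal (fun x hx => ?_) hclosed ha
  replace hx : x ∈ Algebra.adjoin ℂ (carC '' I ∪ star (carC '' I)) := hx
  induction hx using Algebra.adjoin_induction with
  | mem x hx =>
    rcases hx with ⟨i, hi, rfl⟩ | ⟨i, hi, hix⟩
    · exact hcarC i hi
    · rw [← star_star x, ← hix]
      exact hstar i hi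
  | algebraMap r => exact halg r
  | add x y _ _ hx hy => exact hadd x y hx hy
  | mul x y _ _ hx hy => exact hmul x y hx hy

theorem regionAlgebra_univ : regionAlgebra (Set.univ : Set Γ) = ⊤ := by
  have hmap : (StarAlgebra.adjoin ℂ (carC '' (Set.univ : Set Γ))).map (carSubalgebra Γ).subtype =
      StarAlgebra.adjoin ℂ (Set.range fockAnnihilate) := by
    rw [StarAlgHom.map_adjoin, Set.image_univ, ← Set.range_comp]
    rfl
  refine eq_top_iff.2 fun a _ => closure_subtype.2 ?_
  have ha : a.1 ∈ closure ((StarAlgebra.adjoin ℂ (Set.range (fockAnnihilate (Γ := Γ))) :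
      StarSubalgebra ℂ _) : Set (FermionFock Γ →L[ℂ] FermionFock Γ)) := a.2
  rwa [← hmap] at ha

theorem carGrading_pow_mem_regionAlgebra {a : CARAlgebra Γ} (ha : a ∈ regionAlgebra I) (n : ℕ) :
    (carGrading Γ ^ n) a ∈ regionAlgebra I := by
  have hle : regionAlgebra I ≤ (regionAlgebra I).comap (carGrading Γ) :=
    regionAlgebra_le (isClosed_regionAlgebra.preimage continuous_carGrading) fun i hi => by
      rw [StarSubalgebra.mem_comap, carGrading_carC]
      exact neg_mem (carC_mem_regionAlgebra hi)
  induction n with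
  | zero => exact ha
  | succ n ih => rw [pow_succ']; exact hle ih

theorem IsEvenState.apply_carGrading_pow {ψ : CARAlgebra Γ →L[ℂ] ℂ} (hψ : IsEvenState ψ) (n : ℕ)
    (a : CARAlgebra Γ) : ψ ((carGrading Γ ^ n) a) = ψ a := by
  induction n with
  | zero => rfl
  | succ n ih => rw [pow_succ', ← ih]; exact hψ _

/-- The elements `x` that commute with `𝓐(I)` up to the `n`-th power of the grading; for `x` in
the algebra of a region disjoint from `I`, this says that `x` has parity `n`. -/
def GradedCommute (I : Set Γ) (n : ℕ) (x : CARAlgebra Γ) : Prop :=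
  ∀ b ∈ regionAlgebra I, b * x = x * (carGrading Γ ^ n) b

theorem GradedCommute.mul {m n : ℕ} {x y : CARAlgebra Γ} (hx : GradedCommute I m x)
    (hy : GradedCommute I n y) : GradedCommute I (m + n) (x * y) := fun b hb => by
  rw [← mul_assoc, hx b hb, mul_assoc, hy _ (carGrading_pow_mem_regionAlgebra hb m), ← mul_assoc,
    add_comm, pow_add]
  rfl

theorem GradedCommute.star {n : ℕ} {x : CARAlgebra Γ} (hx : GradedCommute I n x) :
    GradedCommute I n (star x) := fun b hb => by
  have h := congrArg Star.star (hx _ (carGrading_pow_mem_regionAlgebra (star_mem hb) n))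
  rwa [carGrading_pow_apply_pow_apply, star_mul, star_mul, star_star, map_star, star_star,
    eq_comm] at h

theorem gradedCommute_one : GradedCommute I 0 1 := fun b _ => by
  rw [mul_one, one_mul]
  rfl

theorem gradedCommute_carC {i : Γ} (hi : i ∉ I) : GradedCommute I 1 (carC i) := fun b hb => by
  rw [pow_one]
  refine regionAlgebra_induction (p := fun b => b * carC i = carC i * carGrading Γ b)
    (isClosed_eq (continuous_mul_const _) (continuous_carGrading.const_mul _))
    (fun j _ => ?_) (fun j hj => ?_) (fun r => ?_) (fun a b ha hb => ?_) (fun a b ha hb => ?_) hb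
  · rw [carGrading_carC, carC_mul_carC, mul_neg]
  · rw [map_star, carGrading_carC, star_neg, mul_neg,
      star_carC_mul_carC (ne_of_mem_of_not_mem hj hi)]
  · rw [AlgHomClass.commutes, Algebra.commutes]
  · rw [add_mul, ha, hb, map_add, mul_add]
  · rw [mul_assoc, hb, ← mul_assoc, ha, map_mul, mul_assoc]

end RegionAlgebras

section MatrixUnits

variable {Γ : Type*} {I : Set Γ} {A B S T U : Finset Γ} {i : Γ}

theorem carC_mul_self (i : Γ) : carC i * carC i = 0 :=
  have : IsAddTorsionFree (CARAlgebra Γ) := .of_module_rat _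
  self_eq_neg.1 (carC_mul_carC i i)

theorem carC_mul_star_mul_carC (i : Γ) : carC i * star (carC i) * carC i = carC i := by
  rw [mul_assoc, eq_sub_of_add_eq (star_carC_mul_self_add i), mul_sub, mul_one, ← mul_assoc,
    carC_mul_self, zero_mul, sub_zero]

theorem GradedCommute.mul_star_self {n : ℕ} {x : CARAlgebra Γ} (hx : GradedCommute I n x) :
    GradedCommute I 0 (x * Star.star x) := fun b hb => by
  rw [hx.mul hx.star b hb, ← two_mul, pow_mul, carGrading_sq, one_pow, pow_zero]

theorem GradedCommute.commute {x b : CARAlgebra Γ} (hx : GradedCommute I 0 x)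
    (hb : b ∈ regionAlgebra I) : Commute b x :=
  hx b hb

theorem gradedCommute_carC_mul_star (hi : i ∉ I) : GradedCommute I 0 (carC i * star (carC i)) :=
  (gradedCommute_carC hi).mul_star_self

theorem carGrading_pow_apply_of_eq {x : CARAlgebra Γ} {k : ℤ} (hx : carGrading Γ x = k • x)
    (n : ℕ) : (carGrading Γ ^ n) x = k ^ n • x := by
  induction n with
  | zero => rw [pow_zero, pow_zero, one_smul]; rfl
  | succ n ih =>
    have h : (carGrading Γ ^ (n + 1)) x = (carGrading Γ ^ n) (carGrading Γ x) := by
      rw [pow_succ]; rfl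
    rw [h, hx, map_zsmul, ih, smul_smul, pow_succ']

theorem commute_carC_mul_star (i j : Γ) :
    Commute (carC i * star (carC i)) (carC j * star (carC j)) := by
  rcases eq_or_ne i j with rfl | h
  · exact Commute.refl _
  · have hi : carC i ∈ regionAlgebra {i} := carC_mem_regionAlgebra rfl
    exact (gradedCommute_carC_mul_star (I := {i}) h.symm).commute (mul_mem hi (star_mem hi))

theorem carVacuum_empty : carVacuum (∅ : Finset Γ) = 1 := by
  simp only [carVacuum, Finset.toList_empty, List.map_nil, List.prod_nil]

theorem toList_union_perm [DecidableEq Γ] (h : Disjoint S T) :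
    ((S ∪ T).toList).Perm (S.toList ++ T.toList) := by
  rw [← Multiset.coe_eq_coe, ← Multiset.coe_add, Finset.coe_toList, Finset.coe_toList,
    Finset.coe_toList, ← Finset.disjUnion_eq_union S T h]
  rfl

theorem carVacuum_union [DecidableEq Γ] (h : Disjoint A B) :
    carVacuum (A ∪ B) = carVacuum A * carVacuum B := by
  rw [carVacuum, carVacuum, carVacuum, ← List.prod_append, ← List.map_append]
  refine ((toList_union_perm h).map _).prod_eq' ?_
  refine List.pairwise_of_forall_mem_list fun _ hx _ hy => ?_
  obtain ⟨i, -, rfl⟩ := List.mem_map.1 hx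
  obtain ⟨j, -, rfl⟩ := List.mem_map.1 hy
  exact commute_carC_mul_star i j

theorem carVacuum_insert [DecidableEq Γ] (hi : i ∉ A) :
    carVacuum (insert i A) = carC i * star (carC i) * carVacuum A := by
  rw [Finset.insert_eq, carVacuum_union (Finset.disjoint_singleton_left.2 hi)]
  simp only [carVacuum, Finset.toList_singleton, List.map_singleton, List.prod_singleton]

theorem carC_mul_carVacuum (hi : i ∈ A) : carC i * carVacuum A = 0 := by
  classical
  rw [← Finset.insert_erase hi, carVacuum_insert (Finset.notMem_erase i A), ← mul_assoc,
    ← mul_assoc, carC_mul_self, zero_mul, zero_mul]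

theorem exists_sign_prod_of_perm {l l' : List Γ} (h : l.Perm l') :
    ∃ ε : ℤˣ, (l.map carC).prod = (ε : ℤ) • (l'.map carC).prod := by
  induction h with
  | nil => exact ⟨1, (one_smul ..).symm⟩
  | cons i _ ih =>
    obtain ⟨ε, h⟩ := ih
    exact ⟨ε, by rw [List.map_cons, List.map_cons, List.prod_cons, List.prod_cons, h,
      mul_smul_comm]⟩
  | swap i j l =>
    refine ⟨-1, ?_⟩
    simp only [List.map_cons, List.prod_cons, Units.val_neg, Units.val_one, neg_smul, one_smul]
    rw [← mul_assoc, ← mul_assoc, carC_mul_carC, neg_mul]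
  | trans _ _ ih ih' =>
    obtain ⟨ε, h⟩ := ih
    obtain ⟨ε', h'⟩ := ih'
    exact ⟨ε * ε', by rw [h, h', smul_smul, Units.val_mul]⟩

theorem exists_sign_carMonomial_union [DecidableEq Γ] (h : Disjoint S T) :
    ∃ ε : ℤˣ, carMonomial (S ∪ T) = (ε : ℤ) • (carMonomial S * carMonomial T) := by
  obtain ⟨ε, hε⟩ := exists_sign_prod_of_perm (toList_union_perm h)
  exact ⟨ε, by rw [carMonomial, hε, List.map_append, List.prod_append, carMonomial, carMonomial]⟩

theorem carMonomial_singleton (i : Γ) : carMonomial {i} = carC i := by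
  simp only [carMonomial, Finset.toList_singleton, List.map_singleton, List.prod_singleton]

theorem exists_sign_carMonomial_insert [DecidableEq Γ] (hi : i ∉ S) :
    ∃ ε : ℤˣ, carMonomial (insert i S) = (ε : ℤ) • (carMonomial S * carC i) := by
  rw [← Finset.union_singleton, ← carMonomial_singleton]
  exact exists_sign_carMonomial_union (Finset.disjoint_singleton_right.2 hi)

theorem carMonomial_mem (h : (S : Set Γ) ⊆ I) : carMonomial S ∈ regionAlgebra I :=
  list_prod_mem fun x hx => by
    obtain ⟨i, hi, rfl⟩ := List.mem_map.1 hx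
    exact carC_mem_regionAlgebra (h (Finset.mem_toList.1 hi))

theorem gradedCommute_carMonomial (h : Disjoint (S : Set Γ) I) :
    GradedCommute I S.card (carMonomial S) := by
  have key : ∀ l : List Γ, (∀ i ∈ l, i ∉ I) → GradedCommute I l.length (l.map carC).prod := by
    intro l hl
    induction l with
    | nil => exact gradedCommute_one
    | cons i l ih =>
      rw [List.length_cons, add_comm, List.map_cons, List.prod_cons]
      exact (gradedCommute_carC (hl i List.mem_cons_self)).mul
        (ih fun j hj => hl j (List.mem_cons_of_mem i hj))
  rw [← S.length_toList]
  exact key _ fun i hi => h.notMem_of_mem_left (Finset.mem_toList.1 hi)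

theorem carGrading_carMonomial (S : Finset Γ) :
    carGrading Γ (carMonomial S) = ((-1) ^ S.card : ℤ) • carMonomial S := by
  have key : ∀ l : List Γ, carGrading Γ (l.map carC).prod =
      ((-1) ^ l.length : ℤ) • (l.map carC).prod := by
    intro l
    induction l with
    | nil => simp only [List.map_nil, List.prod_nil, List.length_nil, map_one, pow_zero, one_smul]
    | cons i l ih =>
      rw [List.map_cons, List.prod_cons, map_mul, ih, carGrading_carC, List.length_cons, pow_succ',
        neg_one_mul, neg_smul, neg_mul, mul_smul_comm]
  rw [← S.length_toList]
  exact key _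

theorem carMonomial_mul_star (S : Finset Γ) :
    carMonomial S * star (carMonomial S) = carVacuum S := by
  classical
  induction S using Finset.induction_on with
  | empty => simp only [carMonomial, carVacuum_empty, Finset.toList_empty, List.map_nil,
      List.prod_nil, star_one, mul_one]
  | insert i S hi ih =>
    obtain ⟨ε, hε⟩ := exists_sign_carMonomial_insert hi
    have hcomm := (gradedCommute_carC_mul_star (I := S) hi).commute
      (carMonomial_mem (S := S) subset_rfl)
    rw [hε, star_zsmul, smul_mul_smul_comm, Int.units_coe_mul_self, one_smul, star_mul,
      carVacuum_insert hi, ← ih, ← mul_assoc, ← mul_assoc, mul_assoc (carMonomial S), hcomm.eq]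

theorem star_carVacuum (A : Finset Γ) : star (carVacuum A) = carVacuum A := by
  rw [← carMonomial_mul_star, star_mul, star_star]

theorem carVacuum_mem (h : (A : Set Γ) ⊆ I) : carVacuum A ∈ regionAlgebra I := by
  rw [← carMonomial_mul_star]
  exact mul_mem (carMonomial_mem h) (star_mem (carMonomial_mem h))

theorem gradedCommute_carVacuum (h : Disjoint (A : Set Γ) I) :
    GradedCommute I 0 (carVacuum A) := by
  rw [← carMonomial_mul_star]
  exact (gradedCommute_carMonomial h).mul_star_self

theorem carGrading_carVacuum (A : Finset Γ) : carGrading Γ (carVacuum A) = carVacuum A := by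
  rw [← carMonomial_mul_star, map_mul, map_star, carGrading_carMonomial, star_zsmul,
    smul_mul_smul_comm, ← mul_pow, neg_one_mul, neg_neg, one_pow, one_smul]

theorem carVacuum_mul_self (A : Finset Γ) : carVacuum A * carVacuum A = carVacuum A := by
  classical
  induction A using Finset.induction_on with
  | empty => rw [carVacuum_empty, one_mul]
  | insert i A hi ih =>
    have hcomm := (gradedCommute_carC_mul_star (I := A) hi).commute
      (carVacuum_mem (A := A) subset_rfl)
    rw [carVacuum_insert hi, hcomm.mul_mul_mul_comm, ih, ← mul_assoc,
      carC_mul_star_mul_carC]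

theorem carVacuum_mul_of_subset (h : S ⊆ A) : carVacuum A * carVacuum S = carVacuum A := by
  classical
  rw [← Finset.sdiff_union_of_subset h, carVacuum_union Finset.sdiff_disjoint, mul_assoc,
    carVacuum_mul_self]

/-- The partial isometry `|∅⟩⟨S|` of `𝓐(A)`, for `S ⊆ A`: it maps the configuration `S` to the empty
configuration of `A` and kills all other configurations. -/
noncomputable def carFrame (A S : Finset Γ) : CARAlgebra Γ :=
  carVacuum A * carMonomial S

theorem carFrame_mem (hA : (A : Set Γ) ⊆ I) (hS : S ⊆ A) : carFrame A S ∈ regionAlgebra I :=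
  mul_mem (carVacuum_mem hA) (carMonomial_mem ((Finset.coe_subset.2 hS).trans hA))

theorem gradedCommute_carFrame (hA : Disjoint (A : Set Γ) I) (hS : S ⊆ A) :
    GradedCommute I S.card (carFrame A S) := by
  have h := (gradedCommute_carVacuum hA).mul
    (gradedCommute_carMonomial (hA.mono_left (Finset.coe_subset.2 hS)))
  rwa [zero_add] at h

theorem carGrading_carFrame (A S : Finset Γ) :
    carGrading Γ (carFrame A S) = ((-1) ^ S.card : ℤ) • carFrame A S := by
  rw [carFrame, map_mul, carGrading_carVacuum, carGrading_carMonomial, mul_smul_comm]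

theorem exists_sign_carFrame_union [DecidableEq Γ] (h : Disjoint A B) (hS : S ⊆ A) (hT : T ⊆ B) :
    ∃ ε : ℤˣ, carFrame (A ∪ B) (S ∪ T) = (ε : ℤ) • (carFrame A S * carFrame B T) := by
  obtain ⟨ε, hε⟩ := exists_sign_carMonomial_union (h.mono hS hT)
  have hcomm : Commute (carMonomial S) (carVacuum B) :=
    (gradedCommute_carVacuum (Finset.disjoint_coe.2 h.symm)).commute
      (carMonomial_mem (Finset.coe_subset.2 hS))
  refine ⟨ε, ?_⟩
  rw [carFrame, hε, carVacuum_union h, mul_smul_comm, hcomm.symm.mul_mul_mul_comm]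
  rfl

theorem carFrame_mul_star_self (hS : S ⊆ A) : carFrame A S * star (carFrame A S) = carVacuum A := by
  rw [carFrame, star_mul, star_carVacuum, ← mul_assoc, mul_assoc (carVacuum A),
    carMonomial_mul_star, carVacuum_mul_of_subset hS, carVacuum_mul_self]

theorem carFrame_mul_star_of_mem (hT : T ⊆ A) (hi : i ∈ T) (hiU : i ∉ U) :
    carFrame A T * star (carFrame A U) = 0 := by
  classical
  obtain ⟨ε, hε⟩ := exists_sign_carMonomial_insert (Finset.notMem_erase i T)
  rw [Finset.insert_erase hi] at hε
  have hcomm : carC i * star (carMonomial U) =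
      star (carMonomial U) * (carGrading Γ ^ U.card) (carC i) :=
    (gradedCommute_carMonomial (Set.disjoint_singleton_right.2 hiU)).star _
      (carC_mem_regionAlgebra rfl)
  have hkill : carC i * star (carFrame A U) = 0 := by
    rw [carFrame, star_mul, star_carVacuum, ← mul_assoc, hcomm, mul_assoc,
      carGrading_pow_apply_of_eq ((carGrading_carC i).trans (neg_one_zsmul _).symm),
      smul_mul_assoc, carC_mul_carVacuum (hT hi), smul_zero, mul_zero]
  rw [carFrame, hε, mul_smul_comm, smul_mul_assoc, mul_assoc, mul_assoc, hkill, mul_zero, mul_zero,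
    smul_zero]

theorem carFrame_mul_star (hT : T ⊆ A) (hU : U ⊆ A) (h : T ≠ U) :
    carFrame A T * star (carFrame A U) = 0 := by
  by_cases hTU : T ⊆ U
  · obtain ⟨i, hi, hiT⟩ := Finset.not_subset.1 fun hUT => h (hTU.antisymm hUT)
    rw [← star_star (carFrame A T), ← star_mul, carFrame_mul_star_of_mem hU hi hiT, star_zero]
  · obtain ⟨i, hi, hiU⟩ := Finset.not_subset.1 hTU
    exact carFrame_mul_star_of_mem hT hi hiU

theorem star_carFrame_mul (A S T : Finset Γ) :
    star (carFrame A S) * carFrame A T = star (carMonomial S) * carVacuum A * carMonomial T := by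
  rw [carFrame, carFrame, star_mul, star_carVacuum, mul_assoc, ← mul_assoc (carVacuum A),
    carVacuum_mul_self, mul_assoc]

theorem star_carFrame_insert_mul_self [DecidableEq Γ] (hi : i ∉ A) (hS : S ⊆ A) :
    star (carFrame (insert i A) S) * carFrame (insert i A) S =
      carC i * star (carC i) * (star (carFrame A S) * carFrame A S) := by
  have hcomm := (gradedCommute_carC_mul_star (I := A) hi).commute
    (b := star (carMonomial S)) (star_mem (carMonomial_mem (Finset.coe_subset.2 hS)))
  rw [star_carFrame_mul, star_carFrame_mul, carVacuum_insert hi, ← mul_assoc, hcomm.eq]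
  simp only [mul_assoc]

theorem star_carFrame_insert_insert_mul_self [DecidableEq Γ] (hi : i ∉ A) (hS : S ⊆ A) :
    star (carFrame (insert i A) (insert i S)) * carFrame (insert i A) (insert i S) =
      star (carC i) * carC i * (star (carFrame A S) * carFrame A S) := by
  obtain ⟨ε, hε⟩ := exists_sign_carMonomial_insert fun h => hi (hS h)
  have hcomm : Commute (carC i) (star (carFrame A S) * carFrame A S) := by
    refine GradedCommute.commute (I := {i}) ?_ (carC_mem_regionAlgebra rfl)
    have h := gradedCommute_carFrame (I := {i}) (Set.disjoint_singleton_right.2 hi) hS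
    simpa only [star_star] using h.star.mul_star_self
  have hnumber : Commute (carFrame A S) (carC i * star (carC i)) :=
    (gradedCommute_carC_mul_star (I := A) hi).commute (carFrame_mem (Set.Subset.refl _) hS)
  have hframe : carFrame (insert i A) (insert i S) = (ε : ℤ) • (carFrame A S * carC i) := by
    rw [carFrame, carVacuum_insert hi, hε, mul_smul_comm, mul_assoc, ← mul_assoc (carVacuum A),
      ← carFrame, ← mul_assoc, ← hnumber.eq, mul_assoc, carC_mul_star_mul_carC]
  rw [hframe, star_zsmul, smul_mul_smul_comm, Int.units_coe_mul_self, one_smul, star_mul,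
    mul_assoc, ← mul_assoc (star (carFrame A S)), ← hcomm.eq, ← mul_assoc]

theorem sum_star_carFrame_mul_self (A : Finset Γ) :
    ∑ S ∈ A.powerset, star (carFrame A S) * carFrame A S = 1 := by
  classical
  induction A using Finset.induction_on with
  | empty => simp only [Finset.powerset_empty, Finset.sum_singleton, carFrame, carVacuum_empty,
      carMonomial, Finset.toList_empty, List.map_nil, List.prod_nil, star_one, mul_one]
  | insert i A hi ih =>
    rw [Finset.sum_powerset_insert hi,
      Finset.sum_congr rfl fun S hS => star_carFrame_insert_mul_self hi (Finset.mem_powerset.1 hS),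
      Finset.sum_congr rfl fun S hS =>
        star_carFrame_insert_insert_mul_self hi (Finset.mem_powerset.1 hS),
      ← Finset.mul_sum, ← Finset.mul_sum, ih, mul_one, mul_one, add_comm, star_carC_mul_self_add]

/-- The matrix unit `|S⟩⟨T|` of `𝓐(A)`, for `S, T ⊆ A`; these are the elements with which
`densityMatrix` reads off the entries of a state. -/
noncomputable def carUnit (A S T : Finset Γ) : CARAlgebra Γ :=
  star (carFrame A S) * carFrame A T

theorem densityMatrix_apply (A : Finset Γ) (ψ : CARAlgebra Γ →L[ℂ] ℂ) (S T : A.powerset) :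
    densityMatrix A ψ S T = ψ (carUnit A T S) := by
  rw [carUnit, star_carFrame_mul]
  rfl

theorem star_carUnit (A S T : Finset Γ) : star (carUnit A S T) = carUnit A T S := by
  rw [carUnit, star_mul, star_star, carUnit]

theorem carUnit_mem (hA : (A : Set Γ) ⊆ I) (hS : S ⊆ A) (hT : T ⊆ A) :
    carUnit A S T ∈ regionAlgebra I :=
  mul_mem (star_mem (carFrame_mem hA hS)) (carFrame_mem hA hT)

theorem carGrading_carUnit (A S T : Finset Γ) :
    carGrading Γ (carUnit A S T) = ((-1) ^ (S.card + T.card) : ℤ) • carUnit A S T := by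
  rw [carUnit, map_mul, map_star, carGrading_carFrame, carGrading_carFrame, star_zsmul,
    smul_mul_smul_comm, pow_add]

theorem gradedCommute_carUnit (hA : Disjoint (A : Set Γ) I) (hS : S ⊆ A) (hT : T ⊆ A) :
    GradedCommute I (S.card + T.card) (carUnit A S T) :=
  (gradedCommute_carFrame hA hS).star.mul (gradedCommute_carFrame hA hT)

theorem carUnit_mul_carUnit_self (hT : T ⊆ A) (S U : Finset Γ) :
    carUnit A S T * carUnit A T U = carUnit A S U := by
  rw [carUnit, carUnit, mul_assoc, ← mul_assoc (carFrame A T), carFrame_mul_star_self hT, carFrame,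
    carFrame, ← mul_assoc (carVacuum A) (carVacuum A), carVacuum_mul_self]
  rfl

theorem carUnit_mul_carUnit_of_ne (hT : T ⊆ A) (hU : U ⊆ A) (h : T ≠ U) (S V : Finset Γ) :
    carUnit A S T * carUnit A U V = 0 := by
  rw [carUnit, carUnit, mul_assoc, ← mul_assoc (carFrame A T), carFrame_mul_star hT hU h, zero_mul,
    mul_zero]

theorem sum_carUnit_self (A : Finset Γ) : ∑ S : A.powerset, carUnit A S S = 1 := by
  rw [Finset.sum_coe_sort A.powerset fun S => carUnit A S S]
  exact sum_star_carFrame_mul_self A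

theorem carFrame_mul_carC_of_mem (hi : i ∈ S) : carFrame A S * carC i = 0 := by
  classical
  obtain ⟨ε, hε⟩ := exists_sign_carMonomial_insert (Finset.notMem_erase i S)
  rw [Finset.insert_erase hi] at hε
  rw [carFrame, hε, mul_smul_comm, smul_mul_assoc, mul_assoc, mul_assoc, carC_mul_self, mul_zero,
    mul_zero, smul_zero]

theorem exists_sign_carFrame_mul_carC [DecidableEq Γ] (hi : i ∉ S) :
    ∃ ε : ℤˣ, carFrame A S * carC i = (ε : ℤ) • carFrame A (insert i S) := by
  obtain ⟨ε, hε⟩ := exists_sign_carMonomial_insert hi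
  refine ⟨ε, ?_⟩
  rw [carFrame, carFrame, hε, mul_smul_comm, smul_smul, Int.units_coe_mul_self, one_smul, mul_assoc]

/-- The linear span of the matrix units of `𝓐(A)`; it is `𝓐(A)` itself. -/
noncomputable def carUnitSpan (A : Finset Γ) : Submodule ℂ (CARAlgebra Γ) :=
  Submodule.span ℂ (Set.range fun p : A.powerset × A.powerset => carUnit A p.1 p.2)

theorem carUnit_mem_carUnitSpan (S T : A.powerset) : carUnit A S T ∈ carUnitSpan A :=
  Submodule.subset_span ⟨(S, T), rfl⟩

theorem carC_mem_carUnitSpan (hi : i ∈ A) : carC i ∈ carUnitSpan A := by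
  classical
  rw [← one_mul (carC i), ← sum_carUnit_self A, Finset.sum_mul]
  refine sum_mem fun S _ => ?_
  rw [carUnit, mul_assoc]
  by_cases hiS : i ∈ (S : Finset Γ)
  · rw [carFrame_mul_carC_of_mem hiS, mul_zero]
    exact zero_mem _
  · obtain ⟨ε, hε⟩ := exists_sign_carFrame_mul_carC (A := A) hiS
    have hT : insert i (S : Finset Γ) ∈ A.powerset :=
      Finset.mem_powerset.2 (Finset.insert_subset hi (Finset.mem_powerset.1 S.2))
    rw [hε, mul_smul_comm]
    exact zsmul_mem (carUnit_mem_carUnitSpan S ⟨_, hT⟩) _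

theorem star_mem_carUnitSpan {x : CARAlgebra Γ} (hx : x ∈ carUnitSpan A) :
    star x ∈ carUnitSpan A := by
  induction hx using Submodule.span_induction with
  | mem x hx =>
    obtain ⟨⟨S, T⟩, rfl⟩ := hx
    rw [star_carUnit]
    exact carUnit_mem_carUnitSpan T S
  | zero => rw [star_zero]; exact zero_mem _
  | add x y _ _ hx hy => rw [star_add]; exact add_mem hx hy
  | smul r x _ hx => rw [star_smul]; exact Submodule.smul_mem _ _ hx

theorem carUnitSpan_mul_self_le (A : Finset Γ) : carUnitSpan A * carUnitSpan A ≤ carUnitSpan A := by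
  rw [carUnitSpan, Submodule.span_mul_span, Submodule.span_le]
  rintro _ ⟨_, ⟨⟨S, T⟩, rfl⟩, _, ⟨⟨U, V⟩, rfl⟩, rfl⟩
  change carUnit A S T * carUnit A U V ∈ carUnitSpan A
  rcases eq_or_ne T U with rfl | h
  · rw [carUnit_mul_carUnit_self (Finset.mem_powerset.1 T.2)]
    exact carUnit_mem_carUnitSpan S V
  · rw [carUnit_mul_carUnit_of_ne (Finset.mem_powerset.1 T.2) (Finset.mem_powerset.1 U.2)
      (Subtype.coe_ne_coe.2 h)]
    exact zero_mem _

theorem isClosed_carUnitSpan (A : Finset Γ) : IsClosed (carUnitSpan A : Set (CARAlgebra Γ)) :=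
  have : FiniteDimensional ℂ (carUnitSpan A) :=
    FiniteDimensional.span_of_finite ℂ (Set.finite_range _)
  (carUnitSpan A).closed_of_finiteDimensional

theorem regionAlgebra_subset_carUnitSpan (A : Finset Γ) :
    (regionAlgebra (A : Set Γ) : Set (CARAlgebra Γ)) ⊆ carUnitSpan A := fun _ ha => by
  have hone : (1 : CARAlgebra Γ) ∈ carUnitSpan A := by
    rw [← sum_carUnit_self A]
    exact sum_mem fun S _ => carUnit_mem_carUnitSpan S S
  refine regionAlgebra_induction (p := (· ∈ carUnitSpan A)) (isClosed_carUnitSpan A)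
    (fun i hi => carC_mem_carUnitSpan hi)
    (fun i hi => star_mem_carUnitSpan (carC_mem_carUnitSpan hi)) (fun r => ?_)
    (fun _ _ => add_mem)
    (fun _ _ hx hy => carUnitSpan_mul_self_le A (Submodule.mul_mem_mul hx hy)) ha
  rw [Algebra.algebraMap_eq_smul_one]
  exact Submodule.smul_mem _ r hone

end MatrixUnits

section ProductState

variable {Γ : Type*} {I : Set Γ} {A : Finset Γ} {φ ψ ω ω' : CARAlgebra Γ →L[ℂ] ℂ}

/-- The closed span of the products `a * b` with `a ∈ 𝓐(I)` and `b ∈ 𝓐(Iᶜ)`; it is the whole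
algebra. -/
noncomputable def mulClosedSpan (I : Set Γ) : Submodule ℂ (CARAlgebra Γ) :=
  (Submodule.span ℂ
    (Set.image2 (· * ·) (regionAlgebra I : Set (CARAlgebra Γ))
      (regionAlgebra Iᶜ))).topologicalClosure

theorem mul_mem_mulClosedSpan {x : CARAlgebra Γ}
    (hx : ∀ a ∈ regionAlgebra I, ∀ b ∈ regionAlgebra Iᶜ, a * b * x ∈ mulClosedSpan I)
    {w : CARAlgebra Γ} (hw : w ∈ mulClosedSpan I) : w * x ∈ mulClosedSpan I := by
  have hle : mulClosedSpan I ≤ (mulClosedSpan I).comap (LinearMap.mulRight ℂ x) :=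
    Submodule.topologicalClosure_minimal _
      (Submodule.span_le.2 <| by rintro _ ⟨a, ha, b, hb, rfl⟩; exact hx a ha b hb)
      (isClosed_closure.preimage (continuous_mul_const x))
  exact hle hw

theorem mulClosedSpan_eq_top (I : Set Γ) : mulClosedSpan I = ⊤ := by
  have hgen : ∀ a ∈ regionAlgebra I, ∀ b ∈ regionAlgebra Iᶜ, a * b ∈ mulClosedSpan I :=
    fun a ha b hb =>
      Submodule.le_topologicalClosure _ (Submodule.subset_span (Set.mem_image2_of_mem ha hb))
  have hleft : ∀ c ∈ regionAlgebra I, GradedCommute Iᶜ 1 c →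
      ∀ w ∈ mulClosedSpan I, w * c ∈ mulClosedSpan I := fun c hc hcomm _ =>
    mul_mem_mulClosedSpan fun a ha b hb => by
      rw [mul_assoc, hcomm b hb, ← mul_assoc]
      exact hgen _ (mul_mem ha hc) _ (carGrading_pow_mem_regionAlgebra hb 1)
  have hright : ∀ c ∈ regionAlgebra Iᶜ, ∀ w ∈ mulClosedSpan I, w * c ∈ mulClosedSpan I :=
    fun c hc _ => mul_mem_mulClosedSpan fun a ha b hb => by
      rw [mul_assoc]
      exact hgen a ha _ (mul_mem hb hc)
  refine eq_top_iff.2 fun x _ => ?_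
  have hx : x ∈ regionAlgebra (Set.univ : Set Γ) := regionAlgebra_univ ▸ StarSubalgebra.mem_top
  rw [← one_mul x]
  refine regionAlgebra_induction (p := fun x => ∀ w ∈ mulClosedSpan I, w * x ∈ mulClosedSpan I)
    ?_ (fun i _ => ?_) (fun i _ => ?_) (fun r w hw => ?_)
    (fun a b ha hb w hw => ?_) (fun a b ha hb w hw => ?_) hx 1 ?_
  · simp only [Set.ofPred_forall]
    exact isClosed_biInter fun w _ => isClosed_closure.preimage (continuous_const_mul w)
  · by_cases hi : i ∈ I
    · exact hleft _ (carC_mem_regionAlgebra hi) (gradedCommute_carC (not_not.2 hi))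
    · exact hright _ (carC_mem_regionAlgebra hi)
  · by_cases hi : i ∈ I
    · exact hleft _ (star_mem (carC_mem_regionAlgebra hi)) (gradedCommute_carC (not_not.2 hi)).star
    · exact hright _ (star_mem (carC_mem_regionAlgebra hi))
  · rw [← Algebra.commutes, ← Algebra.smul_def]
    exact Submodule.smul_mem _ r hw
  · rw [mul_add]
    exact add_mem (ha w hw) (hb w hw)
  · rw [← mul_assoc]
    exact hb _ (ha w hw)
  · simpa only [mul_one] using hgen 1 (one_mem _) 1 (one_mem _)

theorem IsCARProduct.eq (h : IsCARProduct I φ ψ ω) (h' : IsCARProduct I φ ψ ω') : ω = ω' := by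
  have hle : mulClosedSpan I ≤ LinearMap.eqLocus ω.toLinearMap ω'.toLinearMap :=
    Submodule.topologicalClosure_minimal _
      (Submodule.span_le.2 <| by
        rintro _ ⟨a, ha, b, hb, rfl⟩
        exact (h.map_mul a ha b hb).trans (h'.map_mul a ha b hb).symm)
      (isClosed_eq ω.continuous ω'.continuous)
  exact ContinuousLinearMap.ext fun x => hle (mulClosedSpan_eq_top I ▸ Submodule.mem_top)

theorem IsCARProduct.apply_left (h : IsCARProduct I φ ψ ω) (hψ : IsState ψ) {a : CARAlgebra Γ}
    (ha : a ∈ regionAlgebra I) : ω a = φ a := by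
  simpa only [mul_one, hψ.map_one] using h.map_mul a ha 1 (one_mem _)

theorem IsCARProduct.apply_right (h : IsCARProduct I φ ψ ω) (hφ : IsState φ) {b : CARAlgebra Γ}
    (hb : b ∈ regionAlgebra Iᶜ) : ω b = ψ b := by
  simpa only [one_mul, hφ.map_one] using h.map_mul 1 (one_mem _) b hb

/-- The product extension `φ_A ⊗_car ψ_{Aᶜ}` of an arbitrary state `φ` and an even state `ψ`. The
formula pairs `φ (E S T)` with the value of `ψ` on the `(S, T)` coefficient `∑ R, E R S * x * E T R`
of `x` with respect to the matrix units `E` of `𝓐(A)`. -/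
noncomputable def carProduct (A : Finset Γ) (φ ψ : CARAlgebra Γ →L[ℂ] ℂ) :
    CARAlgebra Γ →L[ℂ] ℂ :=
  ∑ R : A.powerset, ∑ S : A.powerset, ∑ T : A.powerset, φ (carUnit A S T) •
    ψ.comp (ContinuousLinearMap.mulLeftRight ℂ (CARAlgebra Γ) (carUnit A R S) (carUnit A T R))

theorem carProduct_apply (A : Finset Γ) (φ ψ : CARAlgebra Γ →L[ℂ] ℂ) (x : CARAlgebra Γ) :
    carProduct A φ ψ x = ∑ R : A.powerset, ∑ S : A.powerset, ∑ T : A.powerset,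
      φ (carUnit A S T) * ψ (carUnit A R S * x * carUnit A T R) := by
  simp only [carProduct, sum_apply, smul_apply, smul_eq_mul, ContinuousLinearMap.comp_apply,
    ContinuousLinearMap.mulLeftRight_apply]

theorem carProduct_nonneg (hφ : IsState φ) (hψ : IsState ψ) (A : Finset Γ) (x : CARAlgebra Γ) :
    0 ≤ carProduct A φ ψ (star x * x) := by
  rw [carProduct_apply]
  refine Finset.sum_nonneg fun R _ => ?_
  have hpos := (hφ.posSemidef_gram fun S : A.powerset => carFrame A S).hadamard
    (hψ.posSemidef_gram fun S : A.powerset => x * carUnit A S R)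
  refine (sum_entries_nonneg hpos).trans_eq
    (Finset.sum_congr rfl fun S _ => Finset.sum_congr rfl fun T _ => ?_)
  rw [Matrix.hadamard_apply, Matrix.of_apply, Matrix.of_apply, star_mul, star_carUnit]
  simp only [carUnit, mul_assoc]

theorem carProduct_carUnit_mul (hψ : IsEvenState ψ) (U V : A.powerset) {b : CARAlgebra Γ}
    (hb : b ∈ regionAlgebra (A : Set Γ)ᶜ) :
    carProduct A φ ψ (carUnit A U V * b) = φ (carUnit A U V) * ψ b := by
  have hsub : ∀ S : A.powerset, (S : Finset Γ) ⊆ A := fun S => Finset.mem_powerset.1 S.2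
  have hcommute : ∀ R S T : A.powerset, carUnit A R S * (carUnit A U V * b) * carUnit A T R =
      carUnit A R S * carUnit A U V *
        (carUnit A T R * (carGrading Γ ^ (T.1.card + R.1.card)) b) := by
    intro R S T
    rw [← gradedCommute_carUnit disjoint_compl_right (hsub T) (hsub R) b hb]
    simp only [mul_assoc]
  have hdiag : ∀ R : A.powerset, ψ (carUnit A R U * carUnit A U V * (carUnit A V R *
      (carGrading Γ ^ (V.1.card + R.1.card)) b)) = ψ (carUnit A R R * b) := by
    intro R
    rw [← mul_assoc, carUnit_mul_carUnit_self (hsub U), carUnit_mul_carUnit_self (hsub V),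
      ← hψ.apply_carGrading_pow (V.1.card + R.1.card) (_ * b), map_mul (carGrading Γ ^ _),
      carGrading_pow_apply_of_eq (carGrading_carUnit A R R), Even.neg_one_pow ⟨_, rfl⟩, one_pow,
      one_smul]
  rw [carProduct_apply]
  calc
    _ = ∑ R : A.powerset, φ (carUnit A U V) * ψ (carUnit A R R * b) := by
      refine Finset.sum_congr rfl fun R _ => ?_
      rw [Finset.sum_eq_single U _ fun h => (h (Finset.mem_univ U)).elim,
        Finset.sum_eq_single V _ fun h => (h (Finset.mem_univ V)).elim, hcommute, hdiag]
      · intro T _ hT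
        rw [hcommute, ← mul_assoc, mul_assoc (carUnit A R U), carUnit_mul_carUnit_of_ne (hsub V)
          (hsub T) (Subtype.coe_ne_coe.2 hT.symm), mul_zero, zero_mul, map_zero, mul_zero]
      · intro S _ hS
        refine Finset.sum_eq_zero fun T _ => ?_
        rw [hcommute, carUnit_mul_carUnit_of_ne (hsub S) (hsub U) (Subtype.coe_ne_coe.2 hS),
          zero_mul, map_zero, mul_zero]
    _ = φ (carUnit A U V) * ψ b := by
      rw [← Finset.mul_sum, ← map_sum, ← Finset.sum_mul, sum_carUnit_self, one_mul]

theorem isCARProduct_carProduct (hφ : IsState φ) (hψ : IsState ψ) (hψ_even : IsEvenState ψ)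
    (A : Finset Γ) : IsCARProduct (A : Set Γ) φ ψ (carProduct A φ ψ) := by
  have hmul : ∀ a ∈ regionAlgebra (A : Set Γ), ∀ b ∈ regionAlgebra (A : Set Γ)ᶜ,
      carProduct A φ ψ (a * b) = φ a * ψ b := by
    intro a ha b hb
    replace ha := regionAlgebra_subset_carUnitSpan A ha
    induction ha using Submodule.span_induction with
    | mem x hx =>
      obtain ⟨⟨S, T⟩, rfl⟩ := hx
      exact carProduct_carUnit_mul hψ_even S T hb
    | zero => rw [zero_mul, map_zero, map_zero, zero_mul]
    | add x y _ _ hx hy => rw [add_mul, map_add, map_add, add_mul, hx, hy]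
    | smul r x _ hx => rw [smul_mul_assoc, map_smul, map_smul, hx, smul_mul_assoc]
  refine ⟨⟨carProduct_nonneg hφ hψ A, ?_⟩, hmul⟩
  simpa only [mul_one, hφ.map_one, hψ.map_one] using hmul 1 (one_mem _) 1 (one_mem _)

end ProductState

section Entropy

open scoped Kronecker

variable {Γ : Type*} {A B : Finset Γ} {φ ψ ω : CARAlgebra Γ →L[ℂ] ℂ}

theorem IsState.isHermitian_densityMatrix (hφ : IsState φ) (A : Finset Γ) :
    (densityMatrix A φ).IsHermitian := by
  ext S T
  rw [Matrix.conjTranspose_apply, densityMatrix_apply, densityMatrix_apply,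
    ← star_carUnit A T S, hφ.map_star, starRingEnd_apply, star_star]

theorem IsState.trace_densityMatrix (hφ : IsState φ) (A : Finset Γ) :
    (densityMatrix A φ).trace = 1 := by
  simp only [Matrix.trace, Matrix.diag_apply, densityMatrix_apply]
  rw [← map_sum, sum_carUnit_self, hφ.map_one]

theorem IsEvenState.apply_carUnit_of_odd (hψ : IsEvenState ψ) {S T : Finset Γ}
    (h : Odd (S.card + T.card)) (A : Finset Γ) : ψ (carUnit A S T) = 0 := by
  have hpar := hψ (carUnit A S T)
  rw [carGrading_carUnit, h.neg_one_pow, neg_one_smul, map_neg] at hpar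
  exact self_eq_neg.1 hpar.symm

/-- The configurations on a disjoint union as pairs of configurations; it reindexes the density
matrix of a product state to compare it with a Kronecker product. -/
noncomputable def powersetUnionEquiv [DecidableEq Γ] (h : Disjoint A B) :
    A.powerset × B.powerset ≃ (A ∪ B).powerset where
  toFun p := ⟨p.1 ∪ p.2, Finset.mem_powerset.2 (Finset.union_subset_union
    (Finset.mem_powerset.1 p.1.2) (Finset.mem_powerset.1 p.2.2))⟩
  invFun S := (⟨S ∩ A, Finset.mem_powerset.2 Finset.inter_subset_right⟩,
    ⟨S ∩ B, Finset.mem_powerset.2 Finset.inter_subset_right⟩)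
  left_inv := by
    rintro ⟨⟨S, hS⟩, ⟨T, hT⟩⟩
    rw [Finset.mem_powerset] at hS hT
    have hTA : T ∩ A = ∅ := Finset.disjoint_iff_inter_eq_empty.1 (h.symm.mono_left hT)
    have hSB : S ∩ B = ∅ := Finset.disjoint_iff_inter_eq_empty.1 (h.mono_left hS)
    simp only [Finset.union_inter_distrib_right, hTA, hSB,
      Finset.inter_eq_left.2 hS, Finset.inter_eq_left.2 hT, Finset.union_empty, Finset.empty_union]
  right_inv := by
    rintro ⟨S, hS⟩
    rw [Finset.mem_powerset] at hS
    simp only [← Finset.inter_union_distrib_left, Finset.inter_eq_left.2 hS]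

theorem coe_subset_compl_of_disjoint (hAB : Disjoint A B) : (B : Set Γ) ⊆ (A : Set Γ)ᶜ :=
  Set.subset_compl_iff_disjoint_left.2 (Finset.disjoint_coe.2 hAB)

theorem IsCARProduct.apply_star_carFrame_mul (hAB : Disjoint A B)
    (h : IsCARProduct (A : Set Γ) φ ψ ω) (hψ : IsEvenState ψ) (p q : A.powerset × B.powerset) :
    ω (star (carFrame A q.1 * carFrame B q.2) * (carFrame A p.1 * carFrame B p.2)) =
      ((-1) ^ (p.1.1.card * p.2.1.card) * (-1) ^ (q.1.1.card * q.2.1.card) : ℤ) •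
        (φ (carUnit A q.1 p.1) * ψ (carUnit B q.2 p.2)) := by
  have hBc := coe_subset_compl_of_disjoint hAB
  have hsub : ∀ {C : Finset Γ} (S : C.powerset), (S : Finset Γ) ⊆ C :=
    fun S => Finset.mem_powerset.1 S.2
  have hcomm : star (carFrame B q.2) * carUnit A q.1 p.1 =
      ((-1) ^ q.2.1.card) ^ (q.1.1.card + p.1.1.card) •
        (carUnit A q.1 p.1 * star (carFrame B q.2)) := by
    rw [gradedCommute_carUnit (I := (A : Set Γ)ᶜ) disjoint_compl_right (hsub _) (hsub _) _
        (star_mem (carFrame_mem hBc (hsub _))), map_star,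
      carGrading_pow_apply_of_eq (carGrading_carFrame B q.2), star_zsmul, mul_smul_comm]
  have hω : ω (star (carFrame A q.1 * carFrame B q.2) * (carFrame A p.1 * carFrame B p.2)) =
      ((-1) ^ q.2.1.card) ^ (q.1.1.card + p.1.1.card) •
        (φ (carUnit A q.1 p.1) * ψ (carUnit B q.2 p.2)) := by
    rw [← h.map_mul _ (carUnit_mem subset_rfl (hsub _) (hsub _)) _
      (carUnit_mem hBc (hsub _) (hsub _)), ← map_zsmul, carUnit.eq_1 B,
      ← mul_assoc (carUnit A _ _), ← smul_mul_assoc, ← hcomm, star_mul, carUnit]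
    simp only [mul_assoc]
  rw [hω]
  -- If `|q.2|` and `|p.2|` have the same parity, the exchange sign splits into a sign for `p` and a
  -- sign for `q`; otherwise the even state `ψ` vanishes.
  rcases Nat.even_or_odd (q.2.1.card + p.2.1.card) with heven | hodd
  · rw [← pow_mul, ← pow_add]
    refine congrArg (· • _) (neg_one_pow_congr ?_)
    rw [Nat.even_add] at heven
    rw [Nat.even_mul, Nat.even_add, Nat.even_add, Nat.even_mul, Nat.even_mul]
    tauto
  · rw [hψ.apply_carUnit_of_odd hodd, mul_zero, smul_zero, smul_zero]

open scoped Classical in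
theorem IsCARProduct.exists_densityMatrix_union_eq (hAB : Disjoint A B)
    (h : IsCARProduct (A : Set Γ) φ ψ ω) (hψ : IsEvenState ψ) :
    ∃ d : A.powerset × B.powerset → ℂ, (∀ p, d p * d p = 1) ∧
      Matrix.reindex (powersetUnionEquiv hAB).symm (powersetUnionEquiv hAB).symm
          (densityMatrix (A ∪ B) ω) =
        Matrix.diagonal d * (densityMatrix A φ ⊗ₖ densityMatrix B ψ) *
          Matrix.diagonal d := by
  choose ε hε using fun p : A.powerset × B.powerset =>
    exists_sign_carFrame_union hAB (Finset.mem_powerset.1 p.1.2) (Finset.mem_powerset.1 p.2.2)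
  refine ⟨fun p => ((ε p * (-1) ^ (p.1.1.card * p.2.1.card) : ℤˣ) : ℤ), fun p => ?_, ?_⟩
  · dsimp only
    rw [← Int.cast_mul, Int.units_coe_mul_self, Int.cast_one]
  · ext p q
    rw [Matrix.mul_diagonal, Matrix.diagonal_mul, Matrix.reindex_apply, Matrix.submatrix_apply,
      densityMatrix_apply, Matrix.kroneckerMap_apply, densityMatrix_apply, densityMatrix_apply]
    change ω (star (carFrame (A ∪ B) (q.1 ∪ q.2)) * carFrame (A ∪ B) (p.1 ∪ p.2)) = _
    rw [hε, hε, star_zsmul, smul_mul_smul_comm, map_zsmul, h.apply_star_carFrame_mul hAB hψ]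
    simp only [zsmul_eq_mul]
    push_cast
    ring

open scoped Classical in
theorem IsCARProduct.charpoly_densityMatrix_union (hAB : Disjoint A B)
    (h : IsCARProduct (A : Set Γ) φ ψ ω) (hψ : IsEvenState ψ) :
    (densityMatrix (A ∪ B) ω).charpoly =
      (densityMatrix A φ ⊗ₖ densityMatrix B ψ).charpoly := by
  obtain ⟨d, hd, heq⟩ := h.exists_densityMatrix_union_eq hAB hψ
  have hdd : Matrix.diagonal d * Matrix.diagonal d = 1 := by
    rw [Matrix.diagonal_mul_diagonal, funext hd, Matrix.diagonal_one]
  rw [← Matrix.charpoly_reindex (powersetUnionEquiv hAB).symm, heq, Matrix.charpoly_mul_comm,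
    ← mul_assoc, hdd, one_mul]

open scoped Classical in
theorem IsCARProduct.vonNeumannEntropy_union (hAB : Disjoint A B)
    (h : IsCARProduct (A : Set Γ) φ ψ ω) (hφ : IsState φ) (hψ : IsState ψ)
    (hψ_even : IsEvenState ψ) :
    vonNeumannEntropy (A ∪ B) ω = vonNeumannEntropy A φ + vonNeumannEntropy B ψ := by
  have hA := hφ.isHermitian_densityMatrix A
  have hB := hψ.isHermitian_densityMatrix B
  have hAB' : (densityMatrix A φ ⊗ₖ densityMatrix B ψ).IsHermitian := by
    rw [Matrix.IsHermitian, Matrix.conjTranspose_kronecker, hA.eq, hB.eq]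
  have hcharpoly := h.charpoly_densityMatrix_union hAB hψ_even
  have htrace := (trace_mul_cfc_congr_charpoly (h.isState.isHermitian_densityMatrix (A ∪ B))
    hAB' Real.log hcharpoly).trans (trace_kronecker_mul_cfc_log hA hB)
  rw [hφ.trace_densityMatrix, hψ.trace_densityMatrix, mul_one, one_mul] at htrace
  rw [vonNeumannEntropy, vonNeumannEntropy, vonNeumannEntropy, htrace, Complex.add_re, neg_add]

theorem IsCARProduct.vonNeumannEntropy_right (hAB : Disjoint A B)
    (h : IsCARProduct (A : Set Γ) φ ψ ω) (hφ : IsState φ) :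
    vonNeumannEntropy B ω = vonNeumannEntropy B ψ := by
  have hD : densityMatrix B ω = densityMatrix B ψ := by
    ext S T
    rw [densityMatrix_apply, densityMatrix_apply]
    exact h.apply_right hφ (carUnit_mem (coe_subset_compl_of_disjoint hAB)
      (Finset.mem_powerset.1 T.2) (Finset.mem_powerset.1 S.2))
  rw [vonNeumannEntropy, vonNeumannEntropy, hD]

theorem IsCARProduct.condEntropy_eq (h : IsCARProduct (A : Set Γ) φ ψ ω) (hφ : IsState φ)
    (hψ : IsState ψ) (hψ_even : IsEvenState ψ) :
    condEntropy A (A : Set Γ)ᶜ ω = (vonNeumannEntropy A φ : EReal) := by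
  classical
  have : Nonempty {Λ : Finset Γ // (Λ : Set Γ) ⊆ (A : Set Γ)ᶜ} :=
    ⟨⟨∅, by rw [Finset.coe_empty]; exact Set.empty_subset _⟩⟩
  refine (iInf_congr fun Λ => ?_).trans iInf_const
  have hAΛ : Disjoint A Λ.1 :=
    Finset.disjoint_coe.1 (Set.subset_compl_iff_disjoint_left.1 Λ.2)
  rw [h.vonNeumannEntropy_union hAΛ hφ hψ hψ_even, h.vonNeumannEntropy_right hAΛ hφ,
    add_sub_cancel_right]

theorem condEntropy_anti (I : Finset Γ) (ψ : CARAlgebra Γ →L[ℂ] ℂ) :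
    Antitone fun J => condEntropy I J ψ :=
  fun _ _ h => le_iInf fun Λ => iInf_le_of_le ⟨Λ.1, Λ.2.trans h⟩ le_rfl

theorem mutualEntropy_mono (ψ : CARAlgebra Γ →L[ℂ] ℂ) (I : Finset Γ) :
    Monotone (mutualEntropy ψ I) :=
  fun _ _ h => EReal.sub_le_sub le_rfl (condEntropy_anti I ψ h)

end Entropy

section AreaLaw

variable {Γ : Type*}

theorem coe_sub_le_of_sub_inv_mul_le {β : ℝ} (hβ : 0 < β) {e e' S : ℝ} {s : EReal}
    (h : (e : EReal) - ((β⁻¹ : ℝ) : EReal) * s ≤ (e' : EReal) - ((β⁻¹ : ℝ) : EReal) * (S : EReal)) :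
    (S : EReal) - s ≤ ((β * (e' - e) : ℝ) : EReal) := by
  induction s with
  | bot =>
    rw [EReal.coe_mul_bot_of_pos (inv_pos.2 hβ), EReal.coe_sub_bot, top_le_iff, ← EReal.coe_mul,
      ← EReal.coe_sub] at h
    exact (EReal.coe_ne_top _ h).elim
  | top => rw [EReal.sub_top]; exact bot_le
  | coe s =>
    rw [← EReal.coe_mul, ← EReal.coe_mul, ← EReal.coe_sub, ← EReal.coe_sub,
      EReal.coe_le_coe_iff] at h
    rw [← EReal.coe_sub, EReal.coe_le_coe_iff]
    have hmul := mul_le_mul_of_nonneg_left h hβ.le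
    rw [mul_sub, mul_sub, mul_inv_cancel_left₀ hβ.ne', mul_inv_cancel_left₀ hβ.ne'] at hmul
    linarith

theorem EvenPotential.innerHamiltonian_mem (Φ : EvenPotential Γ) (A : Finset Γ) :
    Φ.innerHamiltonian A ∈ regionAlgebra (A : Set Γ) :=
  sum_mem fun K hK =>
    regionAlgebra_mono (Finset.coe_subset.2 (Finset.mem_powerset.1 hK)) (Φ.mem_region K)

theorem theorem2_general {β : ℝ} (hβ : 0 < β) {φ : CARAlgebra Γ →L[ℂ] ℂ} (hφ : IsState φ)
    (hφ_even : IsEvenState φ) {A : Finset Γ} {H : CARAlgebra Γ}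
    (hH : H ∈ regionAlgebra (A : Set Γ)) (W : CARAlgebra Γ)
    (hφ_stable : ∀ ψ : CARAlgebra Γ →L[ℂ] ℂ, IsState ψ →
      (∀ a ∈ regionAlgebra (A : Set Γ)ᶜ, ψ a = φ a) →
      (((φ (H + W)).re : ℝ) : EReal) - ((β⁻¹ : ℝ) : EReal) * condEntropy A (A : Set Γ)ᶜ φ ≤
        (((ψ (H + W)).re : ℝ) : EReal) - ((β⁻¹ : ℝ) : EReal) * condEntropy A (A : Set Γ)ᶜ ψ) :
    ∃ ω : CARAlgebra Γ →L[ℂ] ℂ,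
      IsCARProduct (A : Set Γ) φ φ ω ∧
      (∀ ω' : CARAlgebra Γ →L[ℂ] ℂ, IsCARProduct (A : Set Γ) φ φ ω' → ω' = ω) ∧
      (∀ B : Set Γ, B ⊆ (A : Set Γ)ᶜ →
        mutualEntropy φ A B ≤ mutualEntropy φ A (A : Set Γ)ᶜ) ∧
      mutualEntropy φ A (A : Set Γ)ᶜ ≤ ((β * ((ω - φ) W).re : ℝ) : EReal) ∧
      β * ((ω - φ) W).re ≤ 2 * β * ‖W‖ := by
  obtain ⟨ω, hω⟩ : ∃ ω, IsCARProduct (A : Set Γ) φ φ ω :=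
    ⟨_, isCARProduct_carProduct hφ hφ hφ_even A⟩
  refine ⟨ω, hω, fun ω' hω' => hω'.eq hω, fun B hB => mutualEntropy_mono φ A hB, ?_, ?_⟩
  · have hstable := hφ_stable ω hω.isState fun a ha => hω.apply_right hφ ha
    rw [hω.condEntropy_eq hφ hφ hφ_even] at hstable
    have hbound := coe_sub_le_of_sub_inv_mul_le hβ hstable
    have henergy : (ω (H + W)).re - (φ (H + W)).re = ((ω - φ) W).re := by
      rw [map_add, map_add, hω.apply_left hφ hH, sub_apply, Complex.add_re, Complex.add_re,
        Complex.sub_re, add_sub_add_left_eq_sub]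
    rwa [henergy] at hbound
  · rw [mul_comm 2, mul_assoc]
    exact mul_le_mul_of_nonneg_left (hω.isState.re_sub_apply_le hφ W) hβ.le

end AreaLaw

theorem theorem2 {Γ : Type*} (Φ : EvenPotential Γ) (hΦ : Φ.HasSurfaceEnergies)
    (β : ℝ) (hβ : 0 < β) (φ : CARAlgebra Γ →L[ℂ] ℂ) (hφ : IsState φ) (hφ_even : IsEvenState φ)
    (hφ_lts : IsLTS Φ β φ) (A : Finset Γ) :
    ∃ ω : CARAlgebra Γ →L[ℂ] ℂ,
      IsCARProduct (A : Set Γ) φ φ ω ∧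
      (∀ ω' : CARAlgebra Γ →L[ℂ] ℂ, IsCARProduct (A : Set Γ) φ φ ω' → ω' = ω) ∧
      (∀ B : Set Γ, B ⊆ (A : Set Γ)ᶜ →
        mutualEntropy φ A B ≤ mutualEntropy φ A (A : Set Γ)ᶜ) ∧
      mutualEntropy φ A (A : Set Γ)ᶜ ≤
        ((β * ((ω - φ) (Φ.surfaceEnergy A)).re : ℝ) : EReal) ∧
      β * ((ω - φ) (Φ.surfaceEnergy A)).re ≤ 2 * β * ‖Φ.surfaceEnergy A‖ :=
  theorem2_general hβ hφ hφ_even (Φ.innerHamiltonian_mem A) _ (hφ_lts A)
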